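/- Let $g:\mathbb R\to\mathbb R$ be of class $C^2$ with $g,g',g''\in L^1(\mathbb R)$, and put $m_0=\int_{\mathbb R} g(s)^2\,ds$ and $m_2=\int_{\mathbb R} g'(s)^2\,ds$. For $\lambda>0$ let $\{\tau_i\}$ be the points of a Poisson point process on $\mathbb R$ with intensity $\lambda\,ds$, let $X_\lambda(t)=\sum_i \beta_i\, g(t-\tau_i)$ be the shot noise process with impulses $\beta_i=1$ almost surely, and let $$Z_\lambda(t)=\frac{1}{\sqrt\lambda}\bigl(X_\lambda(t)-\mathbb E(X_\lambda(t))\bigr),\qquad t\in\mathbb R .$$ For $\alpha\in\mathbb R$ let $C_{Z_\lambda}(\alpha,[0,1])=\mathbb E\bigl(\#\{t\in[0,1] : Z_\lambda(t)=\alpha\}\bigr)\in[0,\infty]$ be the mean number of crossings of the level $\alpha$ in $[0,1]$. Then there exist constants $a_1,a_2,a_3>0$ depending only on $g$ such that for every $\lambda>0$ the function $\alpha\mapsto C_{Z_\lambda}(\alpha,[0,1])$ is finite almost everywhere and integrable on $\mathbb R$, and its Fourier transform $\widehat{C_{Z_\lambda}}(u,[0,1])=\int_{\mathbb R}e^{iu\alpha}C_{Z_\lambda}(\alpha,[0,1])\,d\alpha$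 satisfies, for every $u\in\mathbb R$ with $|u|<a_1\sqrt\lambda$, $$\Bigl|\widehat{C_{Z_\lambda}}(u,[0,1])-\sqrt{\tfrac{2m_2}{\pi}}\;e^{-m_0u^2/2}\Bigr|\le\frac{a_2+a_3|u|}{\sqrt\lambda}.$$ -/

import Mathlib

open MeasureTheory ProbabilityTheory

noncomputable section

/-- The regularity assumption on the kernel: `g` is of class `C²` and `g`, `g'`, `g''` are
integrable on the line. -/
structure KernelAssumption (g : ℝ → ℝ) : Prop where
  contDiff : ContDiff ℝ 2 g
  integrable : Integrable g
  integrable_deriv : Integrable (deriv g)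
  integrable_deriv_deriv : Integrable (deriv (deriv g))

/-- The number of points `τ i` that fall in `A`. -/
def pointCount {Ω : Type*} (τ : ℕ → Ω → ℝ) (A : Set ℝ) (ω : Ω) : ℕ∞ :=
  {i : ℕ | τ i ω ∈ A}.encard

/-- The random points `τ 0, τ 1, …` are the points of a Poisson point process on the line with
intensity measure `ν` (of infinite total mass, since the enumeration is by `ℕ`): the number of
points in a Borel set of finite `ν`-measure has the Poisson law with parameter the `ν`-measure,
and the numbers of points in pairwise disjoint Borel sets are independent. -/
structure IsPoissonPointProcess {Ω : Type*} [MeasurableSpace Ω] (τ : ℕ → Ω → ℝ)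
    (ν : Measure ℝ) (P : Measure Ω) : Prop where
  measurable : ∀ i, Measurable (τ i)
  count_law : ∀ A : Set ℝ, MeasurableSet A → ν A ≠ ⊤ → ∀ k : ℕ,
    P {ω | pointCount τ A ω = k} = poissonMeasure (ν A).toNNReal {k}
  count_indep : ∀ (n : ℕ) (A : Fin n → Set ℝ), (∀ j, MeasurableSet (A j)) →
    Pairwise (fun j k => Disjoint (A j) (A k)) →
    iIndepFun (fun j ω => pointCount τ (A j) ω) P

/-- The shot noise process `X(t) = ∑ᵢ βᵢ g(t - τᵢ)`. -/
def shotNoise {Ω : Type*} (g : ℝ → ℝ) (β τ : ℕ → Ω → ℝ) (t : ℝ) (ω : Ω) : ℝ :=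
  ∑' i, β i ω * g (t - τ i ω)

/-- The normalized process `(X(t) - E X(t)) / √lam`. -/
def normalizedProcess {Ω : Type*} [MeasurableSpace Ω] (P : Measure Ω) (lam : ℝ)
    (X : ℝ → Ω → ℝ) (t : ℝ) (ω : Ω) : ℝ :=
  (X t ω - ∫ ω', X t ω' ∂P) / √lam

/-- The number of crossings of the level `α` by the path `f` in `[a, b]`. -/
def crossingNumber (f : ℝ → ℝ) (a b α : ℝ) : ℕ∞ :=
  {t : ℝ | t ∈ Set.Icc a b ∧ f t = α}.encard

/-- The mean number of crossings of the level `α` by the process `X` in `[a, b]`, possibly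
infinite. -/
def meanCrossings {Ω : Type*} [MeasurableSpace Ω] (P : Measure Ω) (X : ℝ → Ω → ℝ)
    (a b α : ℝ) : ENNReal :=
  ∫⁻ ω, (crossingNumber (fun t => X t ω) a b α : ENNReal) ∂P

/-- The Fourier transform `u ↦ ∫ e^{iuα} f(α) dα`. -/
def fourierPlus (f : ℝ → ℝ) (u : ℝ) : ℂ :=
  ∫ α : ℝ, Complex.exp (Complex.I * u * α) * (f α : ℂ)

end

/-! ### Campbell's formula and the characteristic functional of a Poisson process -/

section PoissonFunctionals

open Filter Set
open scoped ENNReal NNReal Topology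

/-! Write `Y` for a smooth version of the normalized process, `W` for its derivative in `t`, and `ε
= 1/√lam`. The area formula along each path, integrated over `Ω`, turns the mean crossing function
into the density of the image under `Y` of the measure `|W| dt dP` (`withDensity_meanCrossings`).
Finiteness almost everywhere and integrability follow from `E|W| < ∞`, and the Fourier transform at
`u` becomes the integral over `[0,1]` of `E[exp(iuY) |W|]`. It remains to compare this expectation,
at a fixed time, with its value for independent centred Gaussians of variances `m₀` and `m₂`.

The absolute value is removed by `c |x| = ∫ (1 - cos(vx))/v² dv`. So `c E[exp(iuY)|W|]` is the
integral over `v` of `(φ(u,0) - (φ(u,v) + φ(u,-v))/2)/v²`, where `φ = exp(cumulant)` is the joint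
characteristic function, explicit for a Poisson process. The Gaussian counterpart has integrand
`exp(-m₀u²/2) (1 - exp(-m₂v²/2))/v²`; it factorizes because `∫ g g' = 0`. The same constant `c`
occurs on both sides.

The two integrands are compared on three ranges of `v`, with `M` a common bound for `|g|` and
`|g'|`. For `|v| ≤ 1` the numerators must agree up to `O(ε v²)`: the cumulant is split into its even
and odd parts in `v`, the even part being Gaussian up to that order and the odd part, of order
`ε|v|`, entering only through a square. For `1 < |v| ≤ 1/(2Mε)` the third-order Taylor remainder of
the cumulant is `O(ε)` with cubic growth, absorbed by Gaussian decay of the characteristic function.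
Beyond that the integrands are trivially `O(1/v²)`, which integrates to `O(ε)`. The condition `|u| <
a₁√lam` keeps the frequency `u` in the range where this decay is available. The case `lam < 1` needs
only `E|W| ≤ √lam ∫|g'|`. -/

theorem lintegral_natCast_poissonMeasure (r : ℝ≥0) :
    ∫⁻ k, (k : ℝ≥0∞) ∂(poissonMeasure r) = r := by
  have hterm : ∀ n : ℕ, Real.exp (-r) * r ^ (n + 1) / (n + 1).factorial * ((n + 1 : ℕ) : ℝ)
      = r * (Real.exp (-r) * r ^ n / n.factorial) := by
    intro n
    rw [Nat.factorial_succ]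
    push_cast
    have h1 : ((n : ℝ) + 1) ≠ 0 := by positivity
    have h2 : (n.factorial : ℝ) ≠ 0 := by positivity
    field_simp
    ring
  have hsum : HasSum (fun n : ℕ => Real.exp (-r) * r ^ n / n.factorial * (n : ℝ)) (r : ℝ) := by
    rw [← hasSum_nat_add_iff' 1]
    have := (hasSum_one_poissonMeasure r).mul_left (r : ℝ)
    simp only [Finset.sum_range_one, Nat.cast_zero, mul_zero, sub_zero]
    rw [mul_one] at this
    exact this.congr_fun hterm
  rw [poissonMeasure, lintegral_sum_measure]
  simp only [lintegral_smul_measure, lintegral_dirac, smul_eq_mul]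
  have : ∀ n : ℕ, ENNReal.ofReal (Real.exp (-r) * r ^ n / n.factorial) * (n : ℝ≥0∞)
      = ENNReal.ofReal (Real.exp (-r) * r ^ n / n.factorial * n) := by
    intro n
    rw [ENNReal.ofReal_mul (by positivity), ENNReal.ofReal_natCast]
  simp_rw [this]
  rw [← ENNReal.ofReal_tsum_of_nonneg (fun n => by positivity) hsum.summable, hsum.tsum_eq,
    ENNReal.ofReal_coe_nnreal]

theorem coe_pointCount_eq_tsum {Ω : Type*} (τ : ℕ → Ω → ℝ) (A : Set ℝ) (ω : Ω) :
    (pointCount τ A ω : ℝ≥0∞) = ∑' i, A.indicator (fun _ => (1 : ℝ≥0∞)) (τ i ω) := by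
  rw [pointCount, ← ENNReal.tsum_set_one, tsum_subtype _ (fun _ => (1 : ℝ≥0∞))]
  rfl

variable {Ω : Type*} [MeasurableSpace Ω] {P : Measure Ω} {τ : ℕ → Ω → ℝ} {ν : Measure ℝ}

theorem measurable_pointCount (hτ : ∀ i, Measurable (τ i)) {A : Set ℝ} (hA : MeasurableSet A) :
    Measurable (pointCount τ A) := by
  have h : Measurable fun ω => (pointCount τ A ω : ℝ≥0∞) := by
    simp_rw [coe_pointCount_eq_tsum]
    exact Measurable.tsum fun i => (measurable_const.indicator hA).comp (hτ i)
  refine measurable_to_countable' fun n => ?_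
  have : pointCount τ A ⁻¹' {n} = (fun ω => (pointCount τ A ω : ℝ≥0∞)) ⁻¹' {(n : ℝ≥0∞)} := by
    ext ω; simp
  rw [this]
  exact h (measurableSet_singleton _)

namespace IsPoissonPointProcess

/-- The masses prescribed for the finite counts already sum to one, so none is left for the value
`⊤`. -/
theorem ae_pointCount_ne_top [IsProbabilityMeasure P] (h : IsPoissonPointProcess τ ν P)
    {A : Set ℝ} (hA : MeasurableSet A) (hνA : ν A ≠ ⊤) : ∀ᵐ ω ∂P, pointCount τ A ω ≠ ⊤ := by
  have hm := measurable_pointCount h.measurable hA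
  have hU : {ω | pointCount τ A ω ≠ ⊤} = ⋃ k : ℕ, {ω | pointCount τ A ω = k} := by
    ext ω; simp [ENat.ne_top_iff_exists, eq_comm]
  have hmeas : ∀ k : ℕ, MeasurableSet {ω | pointCount τ A ω = k} := fun k =>
    hm (measurableSet_singleton _)
  have h1 : P {ω | pointCount τ A ω ≠ ⊤} = 1 := by
    rw [hU, measure_iUnion _ hmeas]
    · rw [tsum_congr (h.count_law A hA hνA),
        ← measure_iUnion _ (fun _ => measurableSet_singleton _)]
      · rw [iUnion_of_singleton, measure_univ]
      · intro i j hij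
        exact Set.disjoint_singleton.2 hij
    · intro i j hij
      refine Set.disjoint_left.2 fun ω (h1 : _ = _) (h2 : _ = _) => hij ?_
      exact_mod_cast h1.symm.trans h2
  rw [ae_iff_measure_eq]
  · rw [h1, measure_univ]
  · rw [hU]
    exact (MeasurableSet.iUnion hmeas).nullMeasurableSet

theorem map_toNat_pointCount [IsProbabilityMeasure P] (h : IsPoissonPointProcess τ ν P)
    {A : Set ℝ} (hA : MeasurableSet A) (hνA : ν A ≠ ⊤) :
    P.map (fun ω => (pointCount τ A ω).toNat) = poissonMeasure (ν A).toNNReal := by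
  have hm := measurable_pointCount h.measurable hA
  refine Measure.ext_of_singleton fun k => ?_
  have hm' : Measurable fun ω => (pointCount τ A ω).toNat := Measurable.of_discrete.comp hm
  rw [Measure.map_apply hm' (measurableSet_singleton _), ← h.count_law A hA hνA k]
  refine measure_congr ?_
  filter_upwards [h.ae_pointCount_ne_top hA hνA] with ω hω
  refine propext ?_
  change (pointCount τ A ω).toNat = k ↔ pointCount τ A ω = k
  lift pointCount τ A ω to ℕ using hω with n
  simp

theorem lintegral_pointCount [IsProbabilityMeasure P] (h : IsPoissonPointProcess τ ν P)
    {A : Set ℝ} (hA : MeasurableSet A) (hνA : ν A ≠ ⊤) :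
    ∫⁻ ω, (pointCount τ A ω : ℝ≥0∞) ∂P = ν A := by
  have hm := measurable_pointCount h.measurable hA
  have hm' : Measurable fun ω => (pointCount τ A ω).toNat := Measurable.of_discrete.comp hm
  have h1 : ∫⁻ ω, (pointCount τ A ω : ℝ≥0∞) ∂P
      = ∫⁻ ω, (((pointCount τ A ω).toNat : ℕ) : ℝ≥0∞) ∂P := by
    refine lintegral_congr_ae ?_
    filter_upwards [h.ae_pointCount_ne_top hA hνA] with ω hω
    lift pointCount τ A ω to ℕ using hω with n
    simp
  rw [h1, ← lintegral_map (f := fun k : ℕ => (k : ℝ≥0∞)) .of_discrete hm',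
    h.map_toNat_pointCount hA hνA, lintegral_natCast_poissonMeasure, ENNReal.coe_toNNReal hνA]

/-- The sum of the laws of the points is the intensity measure. -/
theorem sum_map_eq [IsProbabilityMeasure P] [SigmaFinite ν] (h : IsPoissonPointProcess τ ν P) :
    Measure.sum (fun i => P.map (τ i)) = ν := by
  -- By σ-finiteness it suffices to compare on sets of finite `ν`-measure, where the mean count is
  -- the Poisson parameter.
  rw [Measure.ext_iff_of_iUnion_eq_univ (iUnion_spanningSets ν)]
  intro n
  ext B hB
  rw [Measure.restrict_apply hB, Measure.restrict_apply hB]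
  set A := B ∩ spanningSets ν n
  have hA : MeasurableSet A := hB.inter (measurableSet_spanningSets ν n)
  have hνA : ν A ≠ ⊤ :=
    ((measure_mono inter_subset_right).trans_lt (measure_spanningSets_lt_top ν n)).ne
  rw [← h.lintegral_pointCount hA hνA, Measure.sum_apply _ hA]
  simp_rw [coe_pointCount_eq_tsum]
  rw [lintegral_tsum (f := fun i ω => A.indicator (fun _ => (1 : ℝ≥0∞)) (τ i ω)) fun i =>
    ((measurable_const.indicator hA).comp (h.measurable i)).aemeasurable]
  refine tsum_congr fun i => ?_
  rw [Measure.map_apply (h.measurable i) hA, ← lintegral_indicator_one (h.measurable i hA)]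
  rfl

/-- Campbell's formula for nonnegative functions. -/
theorem lintegral_tsum_comp [IsProbabilityMeasure P] [SigmaFinite ν]
    (h : IsPoissonPointProcess τ ν P) {f : ℝ → ℝ≥0∞} (hf : Measurable f) :
    ∫⁻ ω, ∑' i, f (τ i ω) ∂P = ∫⁻ s, f s ∂ν := by
  rw [lintegral_tsum (f := fun i ω => f (τ i ω)) fun i => (hf.comp (h.measurable i)).aemeasurable, ← h.sum_map_eq,
    lintegral_sum_measure]
  exact tsum_congr fun i => (lintegral_map hf (h.measurable i)).symm

theorem ae_summable_norm_comp [IsProbabilityMeasure P] [SigmaFinite ν]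
    (h : IsPoissonPointProcess τ ν P) {f : ℝ → ℝ} (hf : Measurable f) (hfi : Integrable f ν) :
    ∀ᵐ ω ∂P, Summable fun i => ‖f (τ i ω)‖ := by
  have h1 : ∫⁻ ω, ∑' i, ‖f (τ i ω)‖ₑ ∂P ≠ ⊤ := by
    rw [h.lintegral_tsum_comp hf.enorm]
    exact hfi.2.ne
  filter_upwards [ae_lt_top' (AEMeasurable.tsum fun i =>
    (hf.enorm.comp (h.measurable i)).aemeasurable) h1] with ω hω
  have := ENNReal.summable_toReal hω.ne
  simpa using this

theorem aemeasurable_tsum_comp [IsProbabilityMeasure P] [SigmaFinite ν]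
    (h : IsPoissonPointProcess τ ν P) {f : ℝ → ℝ} (hf : Measurable f) (hfi : Integrable f ν) :
    AEMeasurable (fun ω => ∑' i, f (τ i ω)) P := by
  refine aemeasurable_of_tendsto_metrizable_ae atTop
    (f := fun (n : ℕ) ω => ∑ i ∈ Finset.range n, f (τ i ω)) (fun n => ?_) ?_
  · exact (Finset.measurable_fun_sum _ fun i _ => hf.comp (h.measurable i)).aemeasurable
  · filter_upwards [h.ae_summable_norm_comp hf hfi] with ω hω
    exact hω.of_norm.hasSum.tendsto_sum_nat

theorem lintegral_enorm_tsum_comp_le [IsProbabilityMeasure P] [SigmaFinite ν]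
    (h : IsPoissonPointProcess τ ν P) {f : ℝ → ℝ} (hf : Measurable f) :
    ∫⁻ ω, ‖∑' i, f (τ i ω)‖ₑ ∂P ≤ ∫⁻ s, ‖f s‖ₑ ∂ν := by
  rw [← h.lintegral_tsum_comp hf.enorm]
  exact lintegral_mono fun ω => enorm_tsum_le_tsum_enorm

theorem integrable_tsum_comp [IsProbabilityMeasure P] [SigmaFinite ν]
    (h : IsPoissonPointProcess τ ν P) {f : ℝ → ℝ} (hf : Measurable f) (hfi : Integrable f ν) :
    Integrable (fun ω => ∑' i, f (τ i ω)) P :=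
  ⟨(h.aemeasurable_tsum_comp hf hfi).aestronglyMeasurable,
    (h.lintegral_enorm_tsum_comp_le hf).trans_lt hfi.2⟩

/-- Campbell's formula for integrable functions. -/
theorem integral_tsum_comp [IsProbabilityMeasure P] [SigmaFinite ν]
    (h : IsPoissonPointProcess τ ν P) {f : ℝ → ℝ} (hf : Measurable f) (hfi : Integrable f ν) :
    ∫ ω, ∑' i, f (τ i ω) ∂P = ∫ s, f s ∂ν := by
  rw [integral_tsum]
  · have hfi' : Integrable f (Measure.sum fun i => P.map (τ i)) := by rwa [h.sum_map_eq]
    conv_rhs => rw [← h.sum_map_eq]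
    rw [integral_sum_measure hfi']
    exact tsum_congr fun i => (integral_map (h.measurable i).aemeasurable
      hf.aestronglyMeasurable).symm
  · exact fun i => (hf.comp (h.measurable i)).aestronglyMeasurable
  · rw [← lintegral_tsum (f := fun i ω => ‖f (τ i ω)‖ₑ) fun i => (hf.enorm.comp (h.measurable i)).aemeasurable,
      h.lintegral_tsum_comp hf.enorm]
    exact hfi.2.ne

theorem integral_cexp_toNat_pointCount [IsProbabilityMeasure P]
    (h : IsPoissonPointProcess τ ν P) {A : Set ℝ} (hA : MeasurableSet A) (hνA : ν A ≠ ⊤) (c : ℝ) :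
    ∫ ω, Complex.exp (Complex.I * (c * (pointCount τ A ω).toNat : ℝ)) ∂P
      = Complex.exp (ν.real A * (Complex.exp (Complex.I * c) - 1)) := by
  have hm := measurable_pointCount h.measurable hA
  have hm' : Measurable fun ω => (pointCount τ A ω).toNat := Measurable.of_discrete.comp hm
  have h1 := charFun_map_cast_poissonMeasure (ν A).toNNReal c
  rw [charFun_apply, integral_map .of_discrete (by fun_prop), ← h.map_toNat_pointCount hA hνA,
    integral_map hm'.aemeasurable .of_discrete] at h1
  rw [mul_comm Complex.I (c : ℂ)]
  refine Eq.trans ?_ h1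
  refine integral_congr_ae (Eventually.of_forall fun ω => ?_)
  simp [mul_comm]

/-- The characteristic functional on simple functions. -/
theorem integral_cexp_tsum_simpleFunc [IsProbabilityMeasure P] [SigmaFinite ν]
    (h : IsPoissonPointProcess τ ν P) (f : SimpleFunc ℝ ℝ) (hfi : Integrable f ν) :
    ∫ ω, Complex.exp (Complex.I * (∑' i, f (τ i ω) : ℝ)) ∂P
      = Complex.exp (∫ s, (Complex.exp (Complex.I * f s) - 1) ∂ν) := by
  -- Only nonzero values are kept: by integrability their level sets have finite `ν`-measure, which
  -- the level set of zero need not have.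
  set S : Finset ℝ := f.range.filter (· ≠ 0) with hS
  let e : Fin S.card ≃ S := S.equivFin.symm
  let c : Fin S.card → ℝ := fun j => (e j : ℝ)
  let A : Fin S.card → Set ℝ := fun j => f ⁻¹' {c j}
  have hc0 : ∀ j, c j ≠ 0 := fun j => (Finset.mem_filter.1 (e j).2).2
  have hcinj : Function.Injective c := Subtype.val_injective.comp e.injective
  have hA : ∀ j, MeasurableSet (A j) := fun j => f.measurableSet_preimage _
  have hνA : ∀ j, ν (A j) ≠ ⊤ := fun j => ((SimpleFunc.integrable_iff.1 hfi) (c j) (hc0 j)).ne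
  have hdisj : Pairwise fun j k => Disjoint (A j) (A k) := fun j k hjk =>
    Disjoint.preimage _ (Set.disjoint_singleton.2 fun h => hjk (hcinj h))
  -- Kept general in `φ` because it serves twice: with the identity for the sum over the points, and
  -- with `exp(ix) - 1` for the exponent.
  have hrep : ∀ {E : Type} [AddCommMonoid E] (φ : ℝ → E), φ 0 = 0 → ∀ x,
      φ (f x) = ∑ j, (A j).indicator (fun _ => φ (c j)) x := by
    intro E _ φ hφ x
    by_cases hx : f x = 0
    · rw [hx, hφ, Finset.sum_eq_zero]
      intro j _
      refine indicator_of_notMem (fun hxj => hc0 j ?_) _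
      exact (show f x = c j from hxj).symm.trans hx
    · have hxS : f x ∈ S := Finset.mem_filter.2 ⟨SimpleFunc.mem_range_self f x, hx⟩
      have hj : c (e.symm ⟨f x, hxS⟩) = f x := by simp [c]
      rw [Finset.sum_eq_single (e.symm ⟨f x, hxS⟩)]
      · rw [indicator_of_mem (show x ∈ A _ from hj.symm), hj]
      · intro k _ hk
        refine indicator_of_notMem (fun hxk => hk ?_) _
        exact hcinj ((show f x = c k from hxk).symm.trans hj.symm)
      · simp
  have hsum : ∀ᵐ ω ∂P, ∑' i, f (τ i ω) = ∑ j, c j * (pointCount τ (A j) ω).toNat := by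
    filter_upwards [ae_all_iff.2 fun j => h.ae_pointCount_ne_top (hA j) (hνA j)] with ω hω
    have hs : ∀ j, HasSum (fun i => (A j).indicator (fun _ => c j) (τ i ω))
        (c j * (pointCount τ (A j) ω).toNat) := by
      intro j
      have hfin : {i | τ i ω ∈ A j}.Finite := Set.encard_ne_top_iff.1 (hω j)
      have h2 := hasSum_sum_of_ne_finset_zero (s := hfin.toFinset) (L := .unconditional ℕ)
        (f := fun i => (A j).indicator (fun _ => c j) (τ i ω))
        (fun i hi => indicator_of_notMem (fun hh : τ i ω ∈ A j => hi (hfin.mem_toFinset.2 hh)) _)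
      convert h2 using 1
      rw [Finset.sum_congr rfl (g := fun _ => c j)
        (fun i hi => indicator_of_mem (show τ i ω ∈ A j from hfin.mem_toFinset.1 hi) _), Finset.sum_const, nsmul_eq_mul,
        pointCount, hfin.encard_eq_coe_toFinset_card, ENat.toNat_natCast, mul_comm]
    have h3 := hasSum_sum (s := Finset.univ) fun j _ => hs j
    rw [← h3.tsum_eq]
    exact tsum_congr fun i => hrep id rfl _
  calc ∫ ω, Complex.exp (Complex.I * (∑' i, f (τ i ω) : ℝ)) ∂P
      = ∫ ω, ∏ j, Complex.exp (Complex.I * (c j * (pointCount τ (A j) ω).toNat : ℝ)) ∂P := by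
        refine integral_congr_ae ?_
        filter_upwards [hsum] with ω hω
        rw [hω, ← Complex.exp_sum]
        push_cast
        rw [Finset.mul_sum]
    _ = ∏ j, ∫ ω, Complex.exp (Complex.I * (c j * (pointCount τ (A j) ω).toNat : ℝ)) ∂P :=
        (h.count_indep _ A hA hdisj).integral_fun_prod_comp
          (f := fun j n => Complex.exp (Complex.I * (c j * n.toNat : ℝ)))
          (fun j => (measurable_pointCount h.measurable (hA j)).aemeasurable)
          (fun j => .of_discrete)
    _ = Complex.exp (∑ j, ν.real (A j) * (Complex.exp (Complex.I * c j) - 1)) := by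
        rw [Complex.exp_sum]
        exact Finset.prod_congr rfl fun j _ =>
          h.integral_cexp_toNat_pointCount (hA j) (hνA j) (c j)
    _ = _ := by
        congr 1
        have hi : ∀ s, Complex.exp (Complex.I * f s) - 1
            = ∑ j, (A j).indicator (fun _ => Complex.exp (Complex.I * c j) - 1) s :=
          fun s => hrep (fun x => Complex.exp (Complex.I * x) - 1) (by simp) s
        simp_rw [hi]
        rw [integral_finsetSum]
        · refine Finset.sum_congr rfl fun j _ => ?_
          rw [integral_indicator (hA j), setIntegral_const, Complex.real_smul]
        · intro j _
          rw [integrable_indicator_iff (hA j)]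
          exact integrableOn_const (hνA j)

theorem _root_.Complex.norm_cexp_I_mul_sub_cexp_I_mul_le (a b : ℝ) :
    ‖Complex.exp (Complex.I * a) - Complex.exp (Complex.I * b)‖ ≤ ‖a - b‖ := by
  have : Complex.exp (Complex.I * a) - Complex.exp (Complex.I * b)
      = Complex.exp (Complex.I * b) * (Complex.exp (Complex.I * (a - b : ℝ)) - 1) := by
    rw [mul_sub, ← Complex.exp_add]; push_cast; ring_nf
  rw [this, norm_mul, mul_comm Complex.I (b : ℂ), Complex.norm_exp_ofReal_mul_I, one_mul]
  exact Real.norm_exp_I_mul_ofReal_sub_one_le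

/-- The characteristic functional of a Poisson point process. -/
theorem integral_cexp_tsum [IsProbabilityMeasure P] [SigmaFinite ν]
    (h : IsPoissonPointProcess τ ν P) {f : ℝ → ℝ} (hf : Measurable f) (hfi : Integrable f ν) :
    ∫ ω, Complex.exp (Complex.I * (∑' i, f (τ i ω) : ℝ)) ∂P
      = Complex.exp (∫ s, (Complex.exp (Complex.I * f s) - 1) ∂ν) := by
  let F : ℕ → SimpleFunc ℝ ℝ := SimpleFunc.approxOn f hf (range f ∪ {0}) 0 (by simp)
  have hF : Tendsto (fun n => ∫⁻ x, ‖F n x - f x‖ₑ ∂ν) atTop (𝓝 0) :=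
    SimpleFunc.tendsto_approxOn_range_L1_enorm hf hfi
  have hFi : ∀ n, Integrable (F n) ν := fun n => SimpleFunc.integrable_approxOn_range hf hfi n
  -- As `x ↦ exp(ix)` is 1-Lipschitz, both sides of the identity are continuous in `f` for the
  -- `L¹(ν)` norm, the left one by Campbell's inequality. Approximation by simple functions then
  -- suffices.
  have henorm : ∀ a b : ℝ,
      ‖Complex.exp (Complex.I * a) - Complex.exp (Complex.I * b)‖ₑ ≤ ‖a - b‖ₑ := fun a b =>
    enorm_le_iff_norm_le.2 (Complex.norm_cexp_I_mul_sub_cexp_I_mul_le a b)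
  have hint : ∀ {k : ℝ → ℝ}, Measurable k → Integrable k ν →
      Integrable (fun s => Complex.exp (Complex.I * k s) - 1) ν := by
    intro k hk hki
    refine hki.mono (by fun_prop) (Eventually.of_forall fun s => ?_)
    exact Real.norm_exp_I_mul_ofReal_sub_one_le
  have hintP : ∀ {k : ℝ → ℝ}, Measurable k → Integrable k ν →
      Integrable (fun ω => Complex.exp (Complex.I * (∑' i, k (τ i ω) : ℝ))) P := by
    intro k hk hki
    have := h.aemeasurable_tsum_comp hk hki
    refine Integrable.mono' (g := fun _ => (1 : ℝ)) (integrable_const _)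
      (Complex.measurable_exp.comp_aemeasurable
        (this.complex_ofReal.const_mul Complex.I)).aestronglyMeasurable (Eventually.of_forall fun ω => ?_)
    rw [mul_comm, Complex.norm_exp_ofReal_mul_I]
  have hL : Tendsto (fun n => ∫ ω, Complex.exp (Complex.I * (∑' i, F n (τ i ω) : ℝ)) ∂P) atTop
      (𝓝 (∫ ω, Complex.exp (Complex.I * (∑' i, f (τ i ω) : ℝ)) ∂P)) := by
    refine tendsto_integral_of_L1 _ (hintP hf hfi).aestronglyMeasurable
      (Eventually.of_forall fun n => hintP (F n).measurable (hFi n)) ?_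
    refine tendsto_of_tendsto_of_tendsto_of_le_of_le tendsto_const_nhds hF (fun _ => zero_le)
      fun n => ?_
    refine le_trans ?_ (h.lintegral_enorm_tsum_comp_le ((F n).measurable.sub hf))
    refine lintegral_mono_ae ?_
    filter_upwards [h.ae_summable_norm_comp hf hfi,
      h.ae_summable_norm_comp (F n).measurable (hFi n)] with ω h1 h2
    refine (henorm _ _).trans_eq ?_
    rw [← h2.of_norm.tsum_sub h1.of_norm]
  have hR : Tendsto (fun n => Complex.exp (∫ s, (Complex.exp (Complex.I * F n s) - 1) ∂ν)) atTop
      (𝓝 (Complex.exp (∫ s, (Complex.exp (Complex.I * f s) - 1) ∂ν))) := by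
    refine (Complex.continuous_exp.tendsto _).comp ?_
    refine tendsto_integral_of_L1 _ (hint hf hfi).aestronglyMeasurable
      (Eventually.of_forall fun n => hint (F n).measurable (hFi n)) ?_
    refine tendsto_of_tendsto_of_tendsto_of_le_of_le tendsto_const_nhds hF (fun _ => zero_le)
      fun n => lintegral_mono fun s => ?_
    rw [sub_sub_sub_cancel_right]
    exact henorm _ _
  refine tendsto_nhds_unique hL (hR.congr fun n => ?_)
  exact (h.integral_cexp_tsum_simpleFunc (F n) (hFi n)).symm

end IsPoissonPointProcess

end PoissonFunctionals

/-! ### The area formula, measurability of crossing counts, and the integrated Rice formula -/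

section Crossings

open Filter Set
open scoped ENNReal NNReal Topology

/-- Rolle's theorem: two equal values would force a critical point between them. -/
theorem injOn_of_hasDerivAt_ne_zero {f f' : ℝ → ℝ} {s : Set ℝ} (hs : s.OrdConnected)
    (hf : ∀ t, HasDerivAt f (f' t) t) (h0 : ∀ t ∈ s, f' t ≠ 0) : InjOn f s := by
  have key : ∀ x ∈ s, ∀ y ∈ s, x < y → f x ≠ f y := by
    intro x hx y hy hxy hfxy
    obtain ⟨c, hc, hc0⟩ := exists_hasDerivAt_eq_zero hxy
      (fun t _ => (hf t).continuousAt.continuousWithinAt) hfxy (fun t _ => hf t)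
    exact h0 c (hs.out hx hy (Ioo_subset_Icc_self hc)) hc0
  intro x hx y hy hxy
  rcases lt_trichotomy x y with h | h | h
  · exact absurd hxy (key x hx y hy h)
  · exact h
  · exact absurd hxy.symm (key y hy x hx h)

/-- The noncritical points form an open set, hence a countable union of intervals with rational
ends. On each of these Rolle's theorem gives injectivity, which survives when the intervals are made
disjoint. -/
theorem exists_partition_injOn {f f' : ℝ → ℝ} (hf : ∀ t, HasDerivAt f (f' t) t)
    (hf' : Continuous f') : ∃ A : ℕ → Set ℝ, (∀ n, MeasurableSet (A n)) ∧
      Pairwise (Function.onFun Disjoint A) ∧ (∀ n, InjOn f (A n)) ∧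
      ⋃ n, A n = {t | f' t ≠ 0} := by
  classical
  have hU : IsOpen {t | f' t ≠ 0} := isOpen_ne_fun hf' continuous_const
  obtain ⟨e, he⟩ := exists_surjective_nat (ℚ × ℚ)
  let s : ℕ → Set ℝ := fun n =>
    if Ioo ((e n).1 : ℝ) (e n).2 ⊆ {t | f' t ≠ 0} then Ioo ((e n).1 : ℝ) (e n).2 else ∅
  have hsU : ∀ n, s n ⊆ {t | f' t ≠ 0} := by
    intro n; simp only [s]; split_ifs with h
    · exact h
    · exact empty_subset _
  have hsc : ∀ n, (s n).OrdConnected := by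
    intro n; simp only [s]; split_ifs
    · exact ordConnected_Ioo
    · exact ordConnected_empty
  have hsm : ∀ n, MeasurableSet (s n) := fun n => (hsc n).measurableSet
  refine ⟨disjointed s, fun n => .disjointed hsm n, disjoint_disjointed s, fun n => ?_, ?_⟩
  · exact (injOn_of_hasDerivAt_ne_zero (hsc n) hf fun t ht => hsU n ht).mono (disjointed_subset s n)
  · rw [iUnion_disjointed]
    refine Subset.antisymm (iUnion_subset hsU) fun t ht => ?_
    obtain ⟨l, r, ⟨hl, hr⟩, hlr⟩ := mem_nhds_iff_exists_Ioo_subset.1 (hU.mem_nhds ht)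
    obtain ⟨p, hp1, hp2⟩ := exists_rat_btwn hl
    obtain ⟨q, hq1, hq2⟩ := exists_rat_btwn hr
    obtain ⟨n, hn⟩ := he (p, q)
    refine mem_iUnion.2 ⟨n, ?_⟩
    simp only [s, hn]
    rw [if_pos ((Ioo_subset_Ioo hp1.le hq2.le).trans hlr)]
    exact ⟨hp2, hq1⟩

/-- The one-dimensional Sard theorem. It allows critical levels, whose level sets may be infinite,
to be discarded. -/
theorem volume_image_critical_eq_zero {f f' : ℝ → ℝ} {s : Set ℝ}
    (hf : ∀ t, HasDerivAt f (f' t) t) (h0 : ∀ t ∈ s, f' t = 0) : volume (f '' s) = 0 := by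
  refine addHaar_image_eq_zero_of_det_fderivWithin_eq_zero volume (f' := fun _ => 0)
    (fun t ht => ?_) (fun t _ => by simp)
  have := (hf t).hasFDerivAt.hasFDerivWithinAt (s := s)
  rw [h0 t ht] at this
  simpa using this

/-- The area formula in dimension one. -/
theorem lintegral_mul_crossingNumber {f f' : ℝ → ℝ} (hf : ∀ t, HasDerivAt f (f' t) t)
    (hf' : Continuous f') (a b : ℝ) {h : ℝ → ℝ≥0∞} (hh : Measurable h) :
    ∫⁻ α, h α * (crossingNumber f a b α : ℝ≥0∞)
      = ∫⁻ t in Icc a b, h (f t) * ENNReal.ofReal |f' t| := by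
  have hfc : Continuous f := continuous_iff_continuousAt.2 fun t => (hf t).continuousAt
  obtain ⟨A, hAm, hAd, hAi, hAU⟩ := exists_partition_injOn hf hf'
  set B : ℕ → Set ℝ := fun n => A n ∩ Icc a b with hB
  have hBm : ∀ n, MeasurableSet (B n) := fun n => (hAm n).inter measurableSet_Icc
  have hBi : ∀ n, InjOn f (B n) := fun n => (hAi n).mono inter_subset_left
  have hBd : Pairwise (Function.onFun Disjoint B) := fun i j hij =>
    (hAd hij).mono inter_subset_left inter_subset_left
  have himm : ∀ n, MeasurableSet (f '' B n) := fun n =>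
    (hBm n).image_of_continuousOn_injOn hfc.continuousOn (hBi n)
  have hBU : ⋃ n, B n = {t | f' t ≠ 0} ∩ Icc a b := by rw [hB, ← iUnion_inter, hAU]
  set N : Set ℝ := f '' {t | f' t = 0} with hN
  have hN0 : volume N = 0 := volume_image_critical_eq_zero hf fun t ht => ht
  -- Off the critical values a level set contains noncritical points only, and each piece `B n`
  -- contains exactly one of them or none, according to whether the level lies in its image.
  have hcount : ∀ᵐ α : ℝ, (crossingNumber f a b α : ℝ≥0∞)
      = ∑' n, (f '' B n).indicator (fun _ => (1 : ℝ≥0∞)) α := by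
    filter_upwards [measure_eq_zero_iff_ae_notMem.1 hN0] with α hα
    have hset : {t | t ∈ Icc a b ∧ f t = α} = ⋃ n, B n ∩ f ⁻¹' {α} := by
      rw [← iUnion_inter, hBU]
      ext t
      constructor
      · rintro ⟨h1, h2⟩
        exact ⟨⟨fun h0 => hα ⟨t, h0, h2⟩, h1⟩, h2⟩
      · rintro ⟨⟨_, h1⟩, h2⟩
        exact ⟨h1, h2⟩
    have hm : ∀ n, MeasurableSet (B n ∩ f ⁻¹' {α}) := fun n =>
      (hBm n).inter (hfc.measurable (measurableSet_singleton α))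
    rw [crossingNumber, hset, ← Measure.count_apply (MeasurableSet.iUnion hm),
      measure_iUnion (fun i j hij => (hBd hij).mono inter_subset_left inter_subset_left) hm]
    refine tsum_congr fun n => ?_
    by_cases hn : α ∈ f '' B n
    · obtain ⟨t, ht, htα⟩ := hn
      rw [indicator_of_mem (show α ∈ f '' B n from ⟨t, ht, htα⟩)]
      have : B n ∩ f ⁻¹' {α} = {t} := by
        refine Subset.antisymm (fun x hx => ?_) (by rintro x rfl; exact ⟨ht, htα⟩)
        exact hBi n hx.1 ht ((show f x = α from hx.2).trans htα.symm)
      rw [this, Measure.count_singleton]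
    · rw [indicator_of_notMem hn]
      have : B n ∩ f ⁻¹' {α} = ∅ := by
        refine eq_empty_of_forall_notMem fun x hx => hn ⟨x, hx.1, hx.2⟩
      rw [this, measure_empty]
  calc ∫⁻ α, h α * (crossingNumber f a b α : ℝ≥0∞)
      = ∫⁻ α, ∑' n, (f '' B n).indicator h α := by
        refine lintegral_congr_ae ?_
        filter_upwards [hcount] with α hα
        rw [hα, ← ENNReal.tsum_mul_left]
        refine tsum_congr fun n => ?_
        by_cases hn : α ∈ f '' B n <;> simp [hn]
    _ = ∑' n, ∫⁻ α in f '' B n, h α := by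
        rw [lintegral_tsum fun n => (hh.indicator (himm n)).aemeasurable]
        exact tsum_congr fun n => lintegral_indicator (himm n) h
    _ = ∑' n, ∫⁻ t in B n, h (f t) * ENNReal.ofReal |f' t| := by
        refine tsum_congr fun n => ?_
        rw [lintegral_image_eq_lintegral_abs_deriv_mul (hBm n)
          (fun t _ => (hf t).hasDerivWithinAt) (hBi n)]
        simp_rw [mul_comm]
    _ = ∫⁻ t in {t | f' t ≠ 0} ∩ Icc a b, h (f t) * ENNReal.ofReal |f' t| := by
        rw [← lintegral_iUnion hBm hBd, hBU]
    _ = ∫⁻ t in Icc a b, h (f t) * ENNReal.ofReal |f' t| := by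
        -- The critical points can be put back, since the integrand vanishes there.
        have hUm : MeasurableSet {t | f' t ≠ 0} :=
          (hf'.measurable (measurableSet_singleton 0)).compl
        rw [← Measure.restrict_restrict hUm, ← lintegral_indicator hUm]
        refine lintegral_congr fun t => ?_
        by_cases ht : f' t = 0 <;> simp [ht]

variable {Ω : Type*} [MeasurableSpace Ω]

/-- By continuity and compactness, the level is attained on `C` exactly when the distance to it is
arbitrarily small along a countable dense subset of `C`; this is a countable condition. -/
theorem measurableSet_exists_mem_eq {Y : ℝ → Ω → ℝ} (hYm : ∀ t, Measurable (Y t))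
    (hYc : ∀ ω, Continuous fun t => Y t ω) {C : Set ℝ} (hC : IsCompact C) :
    MeasurableSet {p : ℝ × Ω | ∃ t ∈ C, Y t p.2 = p.1} := by
  obtain ⟨D, hDC, hDcount, hCD⟩ :=
    (TopologicalSpace.IsSeparable.of_separableSpace C).exists_countable_dense_subset
  have heq : {p : ℝ × Ω | ∃ t ∈ C, Y t p.2 = p.1}
      = ⋂ n : ℕ, ⋃ d ∈ D, {p : ℝ × Ω | |Y d p.2 - p.1| < 1 / ((n : ℝ) + 1)} := by
    ext ⟨α, ω⟩
    simp only [mem_ofPred_eq, mem_iInter, mem_iUnion, exists_prop]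
    have hcont : Continuous fun t => |Y t ω - α| := ((hYc ω).sub continuous_const).abs
    constructor
    · rintro ⟨t, ht, htα⟩ n
      have hopen : IsOpen {x | |Y x ω - α| < 1 / ((n : ℝ) + 1)} :=
        isOpen_lt hcont continuous_const
      obtain ⟨d, hd1, hd2⟩ := mem_closure_iff.1 (hCD ht) _ hopen
        (by simp only [mem_ofPred_eq, htα, sub_self, abs_zero]; positivity)
      exact ⟨d, hd2, hd1⟩
    · intro hn
      obtain ⟨d, hd, _⟩ := hn 0
      obtain ⟨t, ht, hmin⟩ := hC.exists_isMinOn ⟨d, hDC hd⟩ hcont.continuousOn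
      refine ⟨t, ht, ?_⟩
      by_contra hne
      have hpos : 0 < |Y t ω - α| := abs_pos.2 (sub_ne_zero.2 hne)
      obtain ⟨n, hn'⟩ := exists_nat_one_div_lt hpos
      obtain ⟨d, hd, hlt⟩ := hn n
      exact absurd (hmin (hDC hd)) (not_le.2 (hlt.trans hn'))
  rw [heq]
  refine MeasurableSet.iInter fun n => MeasurableSet.biUnion hDcount fun d _ => ?_
  have := hYm d
  exact measurableSet_lt (by fun_prop) measurable_const

theorem exists_injOn_floor_of_finite {T : Set ℝ} (hT : T.Finite) :
    ∃ n : ℕ, InjOn (fun t : ℝ => ⌊((n : ℝ) + 1) * t⌋) T := by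
  have h : ∀ᶠ n : ℕ in atTop, ∀ x ∈ T, ∀ y ∈ T,
      ⌊((n : ℝ) + 1) * x⌋ = ⌊((n : ℝ) + 1) * y⌋ → x = y := by
    rw [eventually_all_finite hT]
    intro x _
    rw [eventually_all_finite hT]
    intro y _
    by_cases hxy : x = y
    · exact Eventually.of_forall fun _ _ => hxy
    · obtain ⟨m, hm⟩ := exists_nat_gt (1 / |x - y|)
      have hpos : 0 < |x - y| := abs_pos.2 (sub_ne_zero.2 hxy)
      filter_upwards [eventually_ge_atTop m] with n hn heq
      have h1 := Int.abs_sub_lt_one_of_floor_eq_floor heq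
      rw [← mul_sub, abs_mul, abs_of_pos (by positivity : (0 : ℝ) < (n : ℝ) + 1)] at h1
      rw [div_lt_iff₀ hpos] at hm
      have h2 : (m : ℝ) ≤ n := by exact_mod_cast hn
      nlinarith
  obtain ⟨n, hn⟩ := h.exists
  exact ⟨n, fun x hx y hy hxy => hn x hx y hy hxy⟩

/-- A fine enough grid separates any given finite subset of `K`, so counting the cells that meet `K`
recovers its cardinality, infinite values included. Each such count is a sum of indicators, which is
what makes crossing numbers measurable. -/
theorem encard_eq_iSup_encard_floor_image (K : Set ℝ) :
    K.encard = ⨆ n : ℕ, ((fun t : ℝ => ⌊((n : ℝ) + 1) * t⌋) '' K).encard := by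
  refine le_antisymm ?_ (iSup_le fun n => encard_image_le _ _)
  by_contra hlt
  rw [not_le] at hlt
  set s := ⨆ n : ℕ, ((fun t : ℝ => ⌊((n : ℝ) + 1) * t⌋) '' K).encard with hs
  obtain ⟨m, hm⟩ := ENat.ne_top_iff_exists.1 hlt.ne_top
  obtain ⟨T, hTK, hT⟩ := exists_subset_encard_eq (Order.add_one_le_of_lt hlt)
  have hTfin : T.Finite := by
    rw [← encard_ne_top_iff, hT, ← hm]
    exact_mod_cast ENat.natCast_ne_top (m + 1)
  obtain ⟨n, hn⟩ := exists_injOn_floor_of_finite hTfin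
  have h1 : s + 1 ≤ s := by
    rw [← hT, ← hn.encard_image]
    exact (encard_le_encard (image_mono hTK)).trans (le_iSup (fun n : ℕ =>
      ((fun t : ℝ => ⌊((n : ℝ) + 1) * t⌋) '' K).encard) n)
  rw [← hm] at h1
  have h2 : m + 1 ≤ m := by exact_mod_cast h1
  omega

theorem measurable_crossingNumber {Y : ℝ → Ω → ℝ} (hYm : ∀ t, Measurable (Y t))
    (hYc : ∀ ω, Continuous fun t => Y t ω) (a b : ℝ) :
    Measurable fun p : ℝ × Ω => (crossingNumber (fun t => Y t p.2) a b p.1 : ℝ≥0∞) := by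
  have hcell : ∀ (n : ℕ) (k : ℤ), MeasurableSet
      {p : ℝ × Ω | ∃ t, (t ∈ Icc a b ∧ Y t p.2 = p.1) ∧ ⌊((n : ℝ) + 1) * t⌋ = k} := by
    intro n k
    have hpos : (0 : ℝ) < (n : ℝ) + 1 := by positivity
    -- Grid cells are half-open, while the measurability criterion concerns compact sets. The cell
    -- is exhausted by closed intervals stopping `1/(m+1)` short of its right end.
    have heq : {p : ℝ × Ω | ∃ t, (t ∈ Icc a b ∧ Y t p.2 = p.1) ∧ ⌊((n : ℝ) + 1) * t⌋ = k}
        = ⋃ m : ℕ, {p : ℝ × Ω | ∃ t ∈ Icc a b ∩ Icc (k / ((n : ℝ) + 1))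
            ((k + 1) / ((n : ℝ) + 1) - 1 / ((m : ℝ) + 1)), Y t p.2 = p.1} := by
      ext p
      simp only [mem_ofPred_eq, mem_iUnion, Int.floor_eq_iff]
      constructor
      · rintro ⟨t, ⟨h1, h2⟩, h3, h4⟩
        have h5 : t < (k + 1) / ((n : ℝ) + 1) := by rw [lt_div_iff₀ hpos]; linarith
        obtain ⟨m, hm⟩ := exists_nat_one_div_lt (sub_pos.2 h5)
        refine ⟨m, t, ⟨h1, ?_, by linarith⟩, h2⟩
        rw [div_le_iff₀ hpos]; linarith
      · rintro ⟨m, t, ⟨h1, h3, h4⟩, h2⟩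
        have hm : (0 : ℝ) < 1 / ((m : ℝ) + 1) := by positivity
        have h5 : t < (k + 1) / ((n : ℝ) + 1) := by linarith
        rw [lt_div_iff₀ hpos] at h5
        rw [div_le_iff₀ hpos] at h3
        exact ⟨t, ⟨h1, h2⟩, by linarith, by linarith⟩
    rw [heq]
    exact MeasurableSet.iUnion fun m => measurableSet_exists_mem_eq hYm hYc
      (isCompact_Icc.inter isCompact_Icc)
  have hcard : ∀ n : ℕ, Measurable fun p : ℝ × Ω => ((((fun t : ℝ => ⌊((n : ℝ) + 1) * t⌋) ''
      {t | t ∈ Icc a b ∧ Y t p.2 = p.1}).encard : ℕ∞) : ℝ≥0∞) := by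
    intro n
    simp_rw [← ENNReal.tsum_set_one]
    have : ∀ p : ℝ × Ω, ∑' _ : ((fun t : ℝ => ⌊((n : ℝ) + 1) * t⌋) ''
        {t | t ∈ Icc a b ∧ Y t p.2 = p.1}), (1 : ℝ≥0∞)
        = ∑' k : ℤ, {p : ℝ × Ω | ∃ t, (t ∈ Icc a b ∧ Y t p.2 = p.1) ∧
            ⌊((n : ℝ) + 1) * t⌋ = k}.indicator (fun _ => (1 : ℝ≥0∞)) p := fun p =>
      tsum_subtype _ (fun _ => (1 : ℝ≥0∞))
    simp_rw [this]
    exact Measurable.tsum fun k => measurable_const.indicator (hcell n k)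
  simp_rw [crossingNumber, encard_eq_iSup_encard_floor_image, ENat.toENNReal_iSup]
  exact Measurable.iSup hcard

theorem measurable_meanCrossings {P : Measure Ω} [SFinite P] {Y : ℝ → Ω → ℝ}
    (hYm : ∀ t, Measurable (Y t)) (hYc : ∀ ω, Continuous fun t => Y t ω) (a b : ℝ) :
    Measurable (meanCrossings P Y a b) :=
  (measurable_crossingNumber hYm hYc a b).lintegral_prod_right'

/-- Integrated Rice formula. -/
theorem lintegral_mul_meanCrossings {P : Measure Ω} [SFinite P] {Y Y' : ℝ → Ω → ℝ}
    (hYm : ∀ t, Measurable (Y t)) (hY : ∀ ω t, HasDerivAt (fun t => Y t ω) (Y' t ω) t)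
    (hY' : ∀ ω, Continuous fun t => Y' t ω) (a b : ℝ) {h : ℝ → ℝ≥0∞} (hh : Measurable h) :
    ∫⁻ α, h α * meanCrossings P Y a b α
      = ∫⁻ ω, (∫⁻ t in Icc a b, h (Y t ω) * ENNReal.ofReal |Y' t ω|) ∂P := by
  have hYc : ∀ ω, Continuous fun t => Y t ω := fun ω =>
    continuous_iff_continuousAt.2 fun t => (hY ω t).continuousAt
  have hm := measurable_crossingNumber hYm hYc a b
  have h1 : ∀ α, h α * meanCrossings P Y a b α
      = ∫⁻ ω, h α * (crossingNumber (fun t => Y t ω) a b α : ℝ≥0∞) ∂P := fun α =>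
    (lintegral_const_mul _ (hm.comp measurable_prodMk_left)).symm
  simp_rw [h1]
  rw [lintegral_lintegral_swap ((hh.comp measurable_fst).mul hm).aemeasurable]
  exact lintegral_congr fun ω => lintegral_mul_crossingNumber (hY ω) (hY' ω) a b hh

/-- The Rice formula is available for nonnegative test functions. As an identity between measures it
also applies to complex integrands such as `exp(iuα)`. -/
theorem withDensity_meanCrossings {P : Measure Ω} [SFinite P] {Y Y' : ℝ → Ω → ℝ}
    (hYm : ∀ t, Measurable (Y t)) (hY'm : ∀ t, Measurable (Y' t))
    (hY : ∀ ω t, HasDerivAt (fun t => Y t ω) (Y' t ω) t)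
    (hY' : ∀ ω, Continuous fun t => Y' t ω) (a b : ℝ) :
    volume.withDensity (meanCrossings P Y a b)
      = (((volume.restrict (Icc a b)).prod P).withDensity
          (fun p => ENNReal.ofReal |Y' p.1 p.2|)).map (fun p => Y p.1 p.2) := by
  have hYc : ∀ ω, Continuous fun t => Y t ω := fun ω =>
    continuous_iff_continuousAt.2 fun t => (hY ω t).continuousAt
  have hYj : Measurable fun p : ℝ × Ω => Y p.1 p.2 :=
    measurable_uncurry_of_continuous_of_measurable hYc hYm
  have hY'j : Measurable fun p : ℝ × Ω => Y' p.1 p.2 :=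
    measurable_uncurry_of_continuous_of_measurable hY' hY'm
  have hdens : Measurable fun p : ℝ × Ω => ENNReal.ofReal |Y' p.1 p.2| :=
    (measurable_norm.comp hY'j).ennreal_ofReal
  ext s hs
  rw [Measure.map_apply hYj hs, withDensity_apply _ hs, withDensity_apply _ (hYj hs),
    ← lintegral_indicator hs, ← lintegral_indicator (hYj hs),
    lintegral_prod_symm _ (hdens.indicator (hYj hs)).aemeasurable]
  have h1 := lintegral_mul_meanCrossings (P := P) hYm hY hY' a b
    (h := s.indicator fun _ => 1) (measurable_const.indicator hs)
  convert h1 using 1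
  · refine lintegral_congr fun α => ?_
    by_cases hα : α ∈ s <;> simp [hα]
  · refine lintegral_congr fun ω => lintegral_congr fun t => ?_
    by_cases ht : Y t ω ∈ s <;> simp [ht]

/-- Comparing total masses in the identity of measures gives `∫ C(α) dα = E ∫ |Y'|`, finite by
hypothesis. Integrating `exp(iuα)` against both measures and applying Fubini's theorem gives the
transform. -/
theorem meanCrossings_ae_ne_top_and_fourierPlus {P : Measure Ω} [IsFiniteMeasure P]
    {Y Y' : ℝ → Ω → ℝ}
    (hYm : ∀ t, Measurable (Y t)) (hY'm : ∀ t, Measurable (Y' t))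
    (hY : ∀ ω t, HasDerivAt (fun t => Y t ω) (Y' t ω) t)
    (hY' : ∀ ω, Continuous fun t => Y' t ω) (a b : ℝ)
    (hint : Integrable (fun p : ℝ × Ω => Y' p.1 p.2) ((volume.restrict (Icc a b)).prod P)) :
    (∀ᵐ α : ℝ, meanCrossings P Y a b α ≠ ⊤) ∧
    Integrable (fun α => (meanCrossings P Y a b α).toReal) ∧
    ∀ u : ℝ, IntegrableOn
        (fun t => ∫ ω, Complex.exp (Complex.I * u * Y t ω) * (|Y' t ω| : ℝ) ∂P) (Icc a b) ∧
      fourierPlus (fun α => (meanCrossings P Y a b α).toReal) u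
      = ∫ t in Icc a b, (∫ ω, Complex.exp (Complex.I * u * Y t ω) * (|Y' t ω| : ℝ) ∂P) := by
  have hYc : ∀ ω, Continuous fun t => Y t ω := fun ω =>
    continuous_iff_continuousAt.2 fun t => (hY ω t).continuousAt
  have hYj : Measurable fun p : ℝ × Ω => Y p.1 p.2 :=
    measurable_uncurry_of_continuous_of_measurable hYc hYm
  have hY'j : Measurable fun p : ℝ × Ω => Y' p.1 p.2 :=
    measurable_uncurry_of_continuous_of_measurable hY' hY'm
  have hdens : Measurable fun p : ℝ × Ω => ENNReal.ofReal |Y' p.1 p.2| :=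
    (measurable_norm.comp hY'j).ennreal_ofReal
  have hCm := measurable_meanCrossings (P := P) hYm hYc a b
  have hμ := withDensity_meanCrossings (P := P) hYm hY'm hY hY' a b
  have hfin : ∫⁻ α, meanCrossings P Y a b α ≠ ⊤ := by
    have h1 := congrArg (fun μ => μ univ) hμ
    simp only [withDensity_apply _ MeasurableSet.univ, Measure.map_apply hYj MeasurableSet.univ,
      preimage_univ, Measure.restrict_univ] at h1
    rw [h1]
    have h2 := hint.2.ne
    simpa only [← ofReal_norm, Real.norm_eq_abs] using h2
  have hae : ∀ᵐ α : ℝ, meanCrossings P Y a b α < ⊤ := ae_lt_top hCm hfin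
  refine ⟨hae.mono fun _ h => h.ne, integrable_toReal_of_lintegral_ne_top hCm.aemeasurable hfin,
    fun u => ?_⟩
  have hexp : Measurable fun α : ℝ => Complex.exp (Complex.I * u * α) := by fun_prop
  have hI : Integrable
      (fun p : ℝ × Ω => Complex.exp (Complex.I * u * Y p.1 p.2) * (|Y' p.1 p.2| : ℝ))
      ((volume.restrict (Icc a b)).prod P) := by
    refine hint.mono ?_ (Eventually.of_forall fun p => ?_)
    · exact ((hexp.comp hYj).mul
        (measurable_norm.comp hY'j).complex_ofReal).aestronglyMeasurable
    · rw [norm_mul, mul_assoc, ← Complex.ofReal_mul, mul_comm Complex.I,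
        Complex.norm_exp_ofReal_mul_I, one_mul, Complex.norm_real, Real.norm_eq_abs, abs_abs,
        Real.norm_eq_abs]
  refine ⟨hI.integral_prod_left, ?_⟩
  calc fourierPlus (fun α => (meanCrossings P Y a b α).toReal) u
      = ∫ α, Complex.exp (Complex.I * u * α)
          ∂(volume.withDensity (meanCrossings P Y a b)) := by
        rw [integral_withDensity_eq_integral_toReal_smul hCm hae, fourierPlus]
        simp_rw [Complex.real_smul, mul_comm]
    _ = ∫ p : ℝ × Ω, Complex.exp (Complex.I * u * Y p.1 p.2) * (|Y' p.1 p.2| : ℝ)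
          ∂((volume.restrict (Icc a b)).prod P) := by
        rw [hμ, integral_map hYj.aemeasurable hexp.aestronglyMeasurable,
          integral_withDensity_eq_integral_toReal_smul hdens
            (Eventually.of_forall fun _ => ENNReal.ofReal_lt_top)]
        simp_rw [Complex.real_smul, ENNReal.toReal_ofReal (abs_nonneg _), mul_comm]
    _ = _ := integral_prod _ hI

end Crossings

/-! ### A one-dimensional Sobolev inequality -/

section SobolevBound

open Filter Set
open scoped ENNReal NNReal Topology

/-- On an interval of length at least one a `C¹` function is bounded by its `W^{1,1}` norm. -/
theorem enorm_le_lintegral_enorm_add_deriv {h h' : ℝ → ℝ} (hh : ∀ t, HasDerivAt h (h' t) t)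
    (hh' : Continuous h') {a b x : ℝ} (hab : a + 1 ≤ b) (hx : x ∈ Icc a b) :
    ‖h x‖ₑ ≤ ∫⁻ r in Icc a b, (‖h r‖ₑ + ‖h' r‖ₑ) := by
  have hc : Continuous h := continuous_iff_continuousAt.2 fun t => (hh t).continuousAt
  -- At a minimum point `y` of `|h|` the value is at most the mean over the interval, hence at most
  -- `∫ |h|` as the length is at least one. The difference `h x - h y` costs `∫ |h'|`.
  obtain ⟨y, hy, hmin⟩ := isCompact_Icc.exists_isMinOn ⟨x, hx⟩ hc.norm.continuousOn
  have h1 : ‖h y‖ₑ ≤ ∫⁻ r in Icc a b, ‖h r‖ₑ := by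
    calc ‖h y‖ₑ ≤ ‖h y‖ₑ * volume (Icc a b) := by
          refine le_mul_of_one_le_right' ?_
          rw [Real.volume_Icc, ENNReal.one_le_ofReal]
          linarith
      _ = ∫⁻ _ in Icc a b, ‖h y‖ₑ := (setLIntegral_const _ _).symm
      _ ≤ ∫⁻ r in Icc a b, ‖h r‖ₑ :=
          setLIntegral_mono' measurableSet_Icc fun r hr => enorm_le_iff_norm_le.2 (hmin hr)
  have h2 : ‖h x - h y‖ₑ ≤ ∫⁻ r in Icc a b, ‖h' r‖ₑ := by
    rw [← intervalIntegral.integral_eq_sub_of_hasDerivAt (fun t _ => hh t)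
      (hh'.intervalIntegrable y x)]
    have h3 : ‖∫ r in y..x, h' r‖ₑ = ‖∫ r in uIoc y x, h' r‖ₑ := by
      rw [← ofReal_norm, ← ofReal_norm, intervalIntegral.norm_intervalIntegral_eq]
    rw [h3]
    refine (enorm_integral_le_lintegral_enorm _).trans (lintegral_mono_set ?_)
    refine uIoc_subset_uIcc.trans ?_
    exact (convex_Icc a b).ordConnected.uIcc_subset hy hx
  calc ‖h x‖ₑ = ‖h y + (h x - h y)‖ₑ := by rw [add_sub_cancel]
    _ ≤ ‖h y‖ₑ + ‖h x - h y‖ₑ := enorm_add_le _ _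
    _ ≤ _ := by
      rw [lintegral_add_left (by fun_prop)]
      exact add_le_add h1 h2

theorem exists_norm_le_of_integrable_deriv {h h' : ℝ → ℝ} (hh : ∀ t, HasDerivAt h (h' t) t)
    (hh' : Continuous h') (hi : Integrable h) (hi' : Integrable h') : ∃ C, 0 ≤ C ∧ ∀ x, |h x| ≤ C := by
  have hfin : ∫⁻ r, (‖h r‖ₑ + ‖h' r‖ₑ) ≠ ⊤ := by
    rw [lintegral_add_left' hi.aestronglyMeasurable.enorm]
    exact ENNReal.add_ne_top.2 ⟨hi.2.ne, hi'.2.ne⟩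
  refine ⟨_, ENNReal.toReal_nonneg (a := ∫⁻ r, (‖h r‖ₑ + ‖h' r‖ₑ)), fun x => ?_⟩
  have h1 := (enorm_le_lintegral_enorm_add_deriv hh hh' (le_refl (x + 1))
    (x := x) ⟨le_rfl, by linarith⟩).trans (setLIntegral_le_lintegral _ _)
  have h2 := ENNReal.toReal_mono hfin h1
  simpa using h2

end SobolevBound

/-! ### Differentiability of the kernel -/

namespace KernelAssumption

variable {g : ℝ → ℝ}

theorem hasDerivAt (hg : KernelAssumption g) (t : ℝ) : HasDerivAt g (deriv g t) t :=
  (hg.contDiff.differentiable (by norm_num) t).hasDerivAt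

theorem contDiff_deriv (hg : KernelAssumption g) : ContDiff ℝ 1 (deriv g) := by
  have := hg.contDiff
  rw [show (2 : WithTop ℕ∞) = 1 + 1 by norm_num, contDiff_succ_iff_deriv] at this
  exact this.2.2

theorem hasDerivAt_deriv (hg : KernelAssumption g) (t : ℝ) :
    HasDerivAt (deriv g) (deriv (deriv g) t) t :=
  (hg.contDiff_deriv.differentiable (by norm_num) t).hasDerivAt

end KernelAssumption

/-! ### Regularity of the shot noise paths -/

section ShotNoisePaths

open Filter Set
open scoped ENNReal NNReal Topology

variable {Ω : Type*} [MeasurableSpace Ω] {P : Measure Ω} [IsProbabilityMeasure P]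
  {τ : ℕ → Ω → ℝ} {lam : ℝ}

instance sigmaFinite_ofReal_smul_volume (c : ℝ) :
    SigmaFinite (ENNReal.ofReal c • (volume : Measure ℝ)) :=
  inferInstanceAs (SigmaFinite (c.toNNReal • (volume : Measure ℝ)))

/-- The Sobolev inequality on the interval `J` dominates `|h(t - s)|`, uniformly for `t` in `J`, by
a function `F(s)` whose integral is `|J|` times the `W^{1,1}` norm of `h`. By Campbell's formula `∑
F(τ i)` has finite mean, and so converges almost surely. -/
theorem IsPoissonPointProcess.ae_summable_locally_uniform
    (hτ : IsPoissonPointProcess τ (ENNReal.ofReal lam • volume) P) {h h' : ℝ → ℝ}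
    (hh : ∀ t, HasDerivAt h (h' t) t) (hh' : Continuous h') (hi : Integrable h)
    (hi' : Integrable h') :
    ∀ᵐ ω ∂P, ∀ n : ℕ, ∃ u : ℕ → ℝ, Summable u ∧
      ∀ i, ∀ t ∈ Icc (-((n : ℝ) + 1)) (n + 1), ‖h (t - τ i ω)‖ ≤ u i := by
  have hc : Continuous h := continuous_iff_continuousAt.2 fun t => (hh t).continuousAt
  rw [ae_all_iff]
  intro n
  set J := Icc (-((n : ℝ) + 1)) (n + 1) with hJ
  let F : ℝ → ℝ≥0∞ := fun s => ∫⁻ r in J, (‖h (r - s)‖ₑ + ‖h' (r - s)‖ₑ)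
  have hjm : Measurable fun p : ℝ × ℝ => ‖h (p.2 - p.1)‖ₑ + ‖h' (p.2 - p.1)‖ₑ := by fun_prop
  have hFm : Measurable F := hjm.lintegral_prod_right'
  have hFfin : ∫⁻ s, F s ≠ ⊤ := by
    have h1 : ∀ r : ℝ, ∫⁻ s, (‖h (r - s)‖ₑ + ‖h' (r - s)‖ₑ) = ∫⁻ s, (‖h s‖ₑ + ‖h' s‖ₑ) :=
      fun r => lintegral_sub_left_eq_self (fun s => ‖h s‖ₑ + ‖h' s‖ₑ) r
    rw [lintegral_lintegral_swap hjm.aemeasurable]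
    simp_rw [h1]
    rw [setLIntegral_const, lintegral_add_left (by fun_prop)]
    refine ENNReal.mul_ne_top (ENNReal.add_ne_top.2 ⟨hi.2.ne, hi'.2.ne⟩) ?_
    rw [hJ, Real.volume_Icc]
    exact ENNReal.ofReal_ne_top
  have hsum : ∫⁻ ω, ∑' i, F (τ i ω) ∂P ≠ ⊤ := by
    rw [hτ.lintegral_tsum_comp hFm, lintegral_smul_measure, smul_eq_mul]
    exact ENNReal.mul_ne_top ENNReal.ofReal_ne_top hFfin
  filter_upwards [ae_lt_top (Measurable.tsum fun i => hFm.comp (hτ.measurable i)) hsum]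
    with ω hω
  refine ⟨fun i => (F (τ i ω)).toReal, ENNReal.summable_toReal hω.ne, fun i t ht => ?_⟩
  have hFi : F (τ i ω) ≠ ⊤ := ENNReal.ne_top_of_tsum_ne_top hω.ne i
  have hder : ∀ r, HasDerivAt (fun r => h (r - τ i ω)) (h' (r - τ i ω)) r := fun r =>
    (hh _).comp_sub_const r _
  have h1 := ENNReal.toReal_mono hFi (enorm_le_lintegral_enorm_add_deriv hder
    (hh'.comp (continuous_id.sub continuous_const)) (by linarith [n.cast_nonneg (α := ℝ)]) ht)
  simpa using h1

theorem measurable_indicator_tsum {f : ℕ → Ω → ℝ} (hf : ∀ i, Measurable (f i)) {S : Set Ω}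
    (hS : MeasurableSet S) (hsum : ∀ ω ∈ S, Summable fun i => f i ω) :
    Measurable (S.indicator fun ω => ∑' i, f i ω) := by
  refine measurable_of_tendsto_metrizable
    (f := fun (n : ℕ) => S.indicator fun ω => ∑ i ∈ Finset.range n, f i ω) (fun n => ?_) ?_
  · exact (Finset.measurable_fun_sum _ fun i _ => hf i).indicator hS
  · rw [tendsto_pi_nhds]
    intro ω
    by_cases hω : ω ∈ S
    · simp only [indicator_of_mem hω]
      exact (hsum ω hω).hasSum.tendsto_sum_nat
    · simp only [indicator_of_notMem hω]
      exact tendsto_const_nhds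

/-- The shot noise process has a version all of whose paths are of class `C¹`. -/
theorem IsPoissonPointProcess.exists_smooth_version
    (hτ : IsPoissonPointProcess τ (ENNReal.ofReal lam • volume) P) {g : ℝ → ℝ}
    (hg : KernelAssumption g) :
    ∃ X X' : ℝ → Ω → ℝ, (∀ t, Measurable (X t)) ∧ (∀ t, Measurable (X' t)) ∧
      (∀ ω t, HasDerivAt (fun t => X t ω) (X' t ω) t) ∧ (∀ ω, Continuous fun t => X' t ω) ∧
      ∀ᵐ ω ∂P, ∀ t, X t ω = ∑' i, g (t - τ i ω) ∧ X' t ω = ∑' i, deriv g (t - τ i ω) := by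
  have hd1 := hg.hasDerivAt
  have hc1 := hg.contDiff_deriv
  have hcd : Continuous (deriv g) := hc1.continuous
  have hcdd : Continuous (deriv (deriv g)) := hc1.continuous_deriv le_rfl
  have hgc : Continuous g := hg.contDiff.continuous
  -- The second application, to `g'`, uses the integrability of `g''`. It justifies differentiating
  -- the series term by term.
  have hgood := (hτ.ae_summable_locally_uniform hd1 hcd hg.integrable hg.integrable_deriv).and
    (hτ.ae_summable_locally_uniform hg.hasDerivAt_deriv hcdd hg.integrable_deriv hg.integrable_deriv_deriv)
  -- The exceptional set is enlarged to a measurable null set, on which the version is set to zero: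
  -- every path is then `C¹` and measurability is preserved.
  obtain ⟨N, hN, hNm, hN0⟩ := exists_measurable_superset_of_null hgood
  have hSgood : ∀ ω ∈ Nᶜ, _ := fun ω hω => by_contra fun hn => hω (hN hn)
  have hcover : ∀ t : ℝ, ∃ n : ℕ, t ∈ Ioo (-((n : ℝ) + 1)) (n + 1) := by
    intro t
    obtain ⟨n, hn⟩ := exists_nat_gt |t|
    have := abs_lt.1 hn
    exact ⟨n, by linarith, by linarith⟩
  have hs1 : ∀ t, ∀ ω ∈ Nᶜ, Summable fun i => g (t - τ i ω) := by
    intro t ω hω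
    obtain ⟨n, hn⟩ := hcover t
    obtain ⟨u, hu, hb⟩ := (hSgood ω hω).1 n
    exact Summable.of_norm_bounded hu fun i => hb i t (Ioo_subset_Icc_self hn)
  have hs2 : ∀ t, ∀ ω ∈ Nᶜ, Summable fun i => deriv g (t - τ i ω) := by
    intro t ω hω
    obtain ⟨n, hn⟩ := hcover t
    obtain ⟨u, hu, hb⟩ := (hSgood ω hω).2 n
    exact Summable.of_norm_bounded hu fun i => hb i t (Ioo_subset_Icc_self hn)
  refine ⟨fun t => Nᶜ.indicator fun ω => ∑' i, g (t - τ i ω),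
    fun t => Nᶜ.indicator fun ω => ∑' i, deriv g (t - τ i ω), fun t => ?_, fun t => ?_, fun ω t => ?_,
    fun ω => ?_, ?_⟩
  · exact measurable_indicator_tsum
      (fun i => hgc.measurable.comp (measurable_const.sub (hτ.measurable i))) hNm.compl (hs1 t)
  · exact measurable_indicator_tsum
      (fun i => hcd.measurable.comp (measurable_const.sub (hτ.measurable i))) hNm.compl (hs2 t)
  · by_cases hω : ω ∈ Nᶜ
    · simp only [indicator_of_mem hω]
      obtain ⟨n, hn⟩ := hcover t
      obtain ⟨u, hu, hb⟩ := (hSgood ω hω).2 n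
      exact hasDerivAt_tsum_of_isPreconnected hu isOpen_Ioo isPreconnected_Ioo
        (fun i y _ => (hd1 _).comp_sub_const y _)
        (fun i y hy => hb i y (Ioo_subset_Icc_self hy)) hn (hs1 t ω hω) hn
    · simp only [indicator_of_notMem hω]
      exact hasDerivAt_const t 0
  · by_cases hω : ω ∈ Nᶜ
    · simp only [indicator_of_mem hω]
      rw [continuous_iff_continuousAt]
      intro t
      obtain ⟨n, hn⟩ := hcover t
      obtain ⟨u, hu, hb⟩ := (hSgood ω hω).2 n
      refine ContinuousOn.continuousAt (s := Ioo (-((n : ℝ) + 1)) (n + 1)) ?_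
        (isOpen_Ioo.mem_nhds hn)
      exact continuousOn_tsum
        (fun i => (hcd.comp (continuous_id.sub continuous_const)).continuousOn) hu
        fun i y hy => hb i y (Ioo_subset_Icc_self hy)
    · simp only [indicator_of_notMem hω]
      exact continuous_const
  · filter_upwards [measure_eq_zero_iff_ae_notMem.1 hN0] with ω hω t
    exact ⟨indicator_of_mem hω _, indicator_of_mem hω _⟩

end ShotNoisePaths

/-! ### The absolute value as an integral of cosines -/

section AbsoluteValueKernel

open Filter Set
open scoped ENNReal NNReal Topology

/-- The kernel in the representation `|x| = c⁻¹ ∫ (1 - cos (v x)) / v² dv`. -/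
noncomputable def fejerKernel (v : ℝ) : ℝ := (1 - Real.cos v) / v ^ 2

theorem fejerKernel_nonneg (v : ℝ) : 0 ≤ fejerKernel v :=
  div_nonneg (by linarith [Real.cos_le_one v]) (sq_nonneg v)

/-- From `1 - cos v ≤ v²/2` and `1 - cos v ≤ 2` one gets `(1 - cos v)(1 + v²) ≤ v²/2 + 2v²`, hence
the constant `5/2`. -/
theorem fejerKernel_le (v : ℝ) : fejerKernel v ≤ 5 / 2 * (1 + v ^ 2)⁻¹ := by
  rcases eq_or_ne v 0 with rfl | hv
  · norm_num [fejerKernel]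
  have hv2 : 0 < v ^ 2 := by positivity
  rw [fejerKernel, ← div_eq_mul_inv, div_le_div_iff₀ hv2 (by positivity)]
  have h1 := Real.one_sub_sq_div_two_le_cos (x := v)
  have h2 := Real.neg_one_le_cos v
  nlinarith

theorem measurable_fejerKernel : Measurable fejerKernel := by
  unfold fejerKernel
  fun_prop

theorem integrable_fejerKernel : Integrable fejerKernel := by
  refine (integrable_inv_one_add_sq.const_mul (5 / 2)).mono'
    measurable_fejerKernel.aestronglyMeasurable (Eventually.of_forall fun v => ?_)
  rw [Real.norm_of_nonneg (fejerKernel_nonneg v)]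
  exact fejerKernel_le v

theorem integral_fejerKernel_pos : 0 < ∫ v, fejerKernel v := by
  rw [integral_pos_iff_support_of_nonneg fejerKernel_nonneg integrable_fejerKernel]
  refine lt_of_lt_of_le (b := volume (Ioo (0 : ℝ) Real.pi)) ?_ (measure_mono fun v hv => ?_)
  · rw [Real.volume_Ioo]
    simp [Real.pi_pos]
  · refine div_ne_zero ?_ (pow_ne_zero 2 hv.1.ne')
    have := Real.cos_lt_cos_of_nonneg_of_le_pi le_rfl hv.2.le hv.1
    rw [Real.cos_zero] at this
    linarith

theorem one_sub_cos_mul_div_sq (x v : ℝ) :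
    (1 - Real.cos (v * x)) / v ^ 2 = x ^ 2 * fejerKernel (v * x) := by
  rcases eq_or_ne x 0 with rfl | hx
  · simp
  rcases eq_or_ne v 0 with rfl | hv
  · simp [fejerKernel]
  rw [fejerKernel]
  field_simp

theorem integrable_one_sub_cos_mul_div_sq (x : ℝ) :
    Integrable fun v : ℝ => (1 - Real.cos (v * x)) / v ^ 2 := by
  simp_rw [one_sub_cos_mul_div_sq]
  rcases eq_or_ne x 0 with rfl | hx
  · simp
  exact (integrable_fejerKernel.comp_mul_right' hx).const_mul _

/-- Substitution of `v x` for `v`. The integral of the kernel is never evaluated, only its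
positivity matters: it occurs alike in the Gaussian formula. -/
theorem integral_one_sub_cos_mul_div_sq (x : ℝ) :
    ∫ v : ℝ, (1 - Real.cos (v * x)) / v ^ 2 = |x| * ∫ v, fejerKernel v := by
  simp_rw [one_sub_cos_mul_div_sq]
  rcases eq_or_ne x 0 with rfl | hx
  · simp
  rw [integral_const_mul, Measure.integral_comp_mul_right, smul_eq_mul, ← mul_assoc, abs_inv,
    ← sq_abs]
  have : |x| ≠ 0 := abs_ne_zero.2 hx
  field_simp

/-- Expression of a weighted absolute first moment through trigonometric moments. -/
theorem integral_fejerKernel_mul_integral_mul_abs {Ω : Type*} [MeasurableSpace Ω] {P : Measure Ω}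
    [SFinite P] {e : Ω → ℂ} (he : Measurable e) (he1 : ∀ ω, ‖e ω‖ ≤ 1) {W : Ω → ℝ}
    (hWm : Measurable W) (hW : Integrable W P) :
    Integrable (fun v : ℝ => ∫ ω, e ω * ((1 - Real.cos (v * W ω)) / v ^ 2 : ℝ) ∂P) ∧
    ((∫ v, fejerKernel v : ℝ) : ℂ) * ∫ ω, e ω * (|W ω| : ℝ) ∂P
      = ∫ v : ℝ, ∫ ω, e ω * ((1 - Real.cos (v * W ω)) / v ^ 2 : ℝ) ∂P := by
  have hnn : ∀ (x v : ℝ), 0 ≤ (1 - Real.cos (v * x)) / v ^ 2 := fun x v =>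
    div_nonneg (by linarith [Real.cos_le_one (v * x)]) (sq_nonneg v)
  have hm : Measurable fun p : Ω × ℝ => e p.1 * ((1 - Real.cos (p.2 * W p.1)) / p.2 ^ 2 : ℝ) := by
    fun_prop
  have hb : ∀ (ω : Ω) (v : ℝ), ‖e ω * ((1 - Real.cos (v * W ω)) / v ^ 2 : ℝ)‖
      ≤ (1 - Real.cos (v * W ω)) / v ^ 2 := by
    intro ω v
    rw [norm_mul, Complex.norm_real, Real.norm_of_nonneg (hnn _ _)]
    exact mul_le_of_le_one_left (hnn _ _) (he1 ω)
  have hsec : ∀ ω, Integrable fun v : ℝ => e ω * ((1 - Real.cos (v * W ω)) / v ^ 2 : ℝ) := fun ω =>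
    ((integrable_one_sub_cos_mul_div_sq (W ω)).ofReal).const_mul _
  -- Fubini's theorem applies because the norm has `v`-integral at most `c |W|`, with `c` the
  -- integral of the kernel, and `W` is integrable.
  have hint : Integrable (fun p : Ω × ℝ => e p.1 * ((1 - Real.cos (p.2 * W p.1)) / p.2 ^ 2 : ℝ))
      (P.prod volume) := by
    rw [integrable_prod_iff hm.aestronglyMeasurable]
    refine ⟨Eventually.of_forall hsec, ?_⟩
    refine (hW.norm.mul_const (∫ v, fejerKernel v)).mono'
      hm.norm.aestronglyMeasurable.integral_prod_right' (Eventually.of_forall fun ω => ?_)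
    rw [Real.norm_of_nonneg (integral_nonneg fun v => norm_nonneg _), Real.norm_eq_abs,
      ← integral_one_sub_cos_mul_div_sq]
    exact integral_mono (hsec ω).norm (integrable_one_sub_cos_mul_div_sq (W ω)) (hb ω)
  refine ⟨hint.integral_prod_right, ?_⟩
  rw [← integral_const_mul, ← integral_integral_swap hint]
  refine integral_congr_ae (Eventually.of_forall fun ω => ?_)
  simp only
  rw [integral_const_mul, integral_complex_ofReal, integral_one_sub_cos_mul_div_sq]
  push_cast
  ring

theorem integral_abs_gaussianReal {m : ℝ} (hm : 0 < m) :
    ∫ x, |x| ∂(gaussianReal 0 m.toNNReal) = √(2 * m / Real.pi) := by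
  have hm' : m.toNNReal ≠ 0 := by simpa using hm
  have h1 : ∫ r : ℝ in Ioi 0, r * Real.exp (-(2 * m)⁻¹ * r ^ 2) = m := by
    have h2 := integral_mul_cexp_neg_mul_sq (b := ((2 * m)⁻¹ : ℝ))
      (by rw [Complex.ofReal_re]; positivity)
    have h3 : ∀ r : ℝ, (r : ℂ) * Complex.exp (-((2 * m)⁻¹ : ℝ) * r ^ 2)
        = ((r * Real.exp (-(2 * m)⁻¹ * r ^ 2) : ℝ) : ℂ) := by intro r; push_cast; rfl
    simp_rw [h3] at h2
    rw [integral_complex_ofReal] at h2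
    have h4 : (2 * (((2 * m)⁻¹ : ℝ) : ℂ))⁻¹ = (m : ℂ) := by
      have : (m : ℂ) ≠ 0 := by exact_mod_cast hm.ne'
      push_cast
      field_simp
    rw [h4] at h2
    exact_mod_cast h2
  rw [integral_gaussianReal_eq_integral_smul hm']
  have h5 : ∀ x : ℝ, gaussianPDFReal 0 m.toNNReal x • |x|
      = (√(2 * Real.pi * m))⁻¹ * (|x| * Real.exp (-(2 * m)⁻¹ * |x| ^ 2)) := by
    intro x
    rw [gaussianPDFReal, Real.coe_toNNReal _ hm.le, smul_eq_mul, sq_abs, sub_zero, neg_mul,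
      neg_div, div_eq_inv_mul (x ^ 2)]
    ring
  simp_rw [h5]
  rw [integral_const_mul, integral_comp_abs (f := fun x => x * Real.exp (-(2 * m)⁻¹ * x ^ 2)), h1]
  symm
  rw [Real.sqrt_eq_iff_mul_self_eq (by positivity) (by positivity)]
  have h6 : √(2 * Real.pi * m) * √(2 * Real.pi * m) = 2 * Real.pi * m :=
    Real.mul_self_sqrt (by positivity)
  have h7 : (√(2 * Real.pi * m))⁻¹ * (2 * m) * ((√(2 * Real.pi * m))⁻¹ * (2 * m))
      = (√(2 * Real.pi * m) * √(2 * Real.pi * m))⁻¹ * (4 * m ^ 2) := by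
    rw [mul_inv]; ring
  rw [h7, h6]
  have := Real.pi_pos
  field_simp
  ring

/-- The Gaussian counterpart of the kernel representation. -/
theorem integral_fejerKernel_mul_sqrt {m : ℝ} (hm : 0 < m) :
    Integrable (fun v : ℝ => (1 - Real.exp (-(m * v ^ 2 / 2))) / v ^ 2) ∧
    (∫ v, fejerKernel v) * √(2 * m / Real.pi)
      = ∫ v : ℝ, (1 - Real.exp (-(m * v ^ 2 / 2))) / v ^ 2 := by
  have hid : Integrable (fun x : ℝ => x) (gaussianReal 0 m.toNNReal) :=
    (memLp_id_gaussianReal 1).integrable le_rfl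
  obtain ⟨h1, h2⟩ := integral_fejerKernel_mul_integral_mul_abs
    (P := gaussianReal 0 m.toNNReal) (e := fun _ => 1) (W := fun x => x) measurable_const
    (by simp) measurable_id hid
  have hcos : ∀ v : ℝ, ∫ x, Real.cos (v * x) ∂(gaussianReal 0 m.toNNReal)
      = Real.exp (-(m * v ^ 2 / 2)) := by
    intro v
    have h3 := charFun_gaussianReal (μ := 0) (v := m.toNNReal) v
    rw [charFun_apply_real] at h3
    have h4 := congrArg Complex.re h3
    have hi : Integrable (fun x : ℝ => Complex.exp (v * x * Complex.I))
        (gaussianReal 0 m.toNNReal) := by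
      refine Integrable.mono' (integrable_const (1 : ℝ)) (by fun_prop)
        (Eventually.of_forall fun x => ?_)
      rw [← Complex.ofReal_mul, Complex.norm_exp_ofReal_mul_I]
    rw [← RCLike.re_eq_complex_re, ← integral_re hi] at h4
    have h5 : ∀ x : ℝ, RCLike.re (Complex.exp (v * x * Complex.I)) = Real.cos (v * x) := by
      intro x
      rw [RCLike.re_eq_complex_re, ← Complex.ofReal_mul, Complex.exp_ofReal_mul_I_re]
    simp_rw [h5] at h4
    rw [h4, Real.coe_toNNReal _ hm.le, RCLike.re_eq_complex_re]
    have h6 : (v : ℂ) * ((0 : ℝ) : ℂ) * Complex.I - (m : ℂ) * v ^ 2 / 2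
        = ((-(m * v ^ 2 / 2) : ℝ) : ℂ) := by push_cast; ring
    rw [h6, ← Complex.ofReal_exp, Complex.ofReal_re]
  have hin : ∀ v : ℝ, ∫ x, (1 : ℂ) * ((1 - Real.cos (v * x)) / v ^ 2 : ℝ)
      ∂(gaussianReal 0 m.toNNReal) = ((1 - Real.exp (-(m * v ^ 2 / 2))) / v ^ 2 : ℝ) := by
    intro v
    simp_rw [one_mul]
    rw [integral_complex_ofReal, integral_div, integral_sub (integrable_const _), hcos]
    · simp
    · refine Integrable.mono' (integrable_const (1 : ℝ)) (by fun_prop)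
        (Eventually.of_forall fun x => Real.abs_cos_le_one _)
  simp_rw [hin] at h1 h2
  refine ⟨by simpa only [RCLike.re_eq_complex_re, Complex.ofReal_re] using h1.re, ?_⟩
  simp_rw [one_mul] at h2
  rw [integral_complex_ofReal, integral_complex_ofReal, integral_abs_gaussianReal hm] at h2
  exact_mod_cast h2

end AbsoluteValueKernel

/-! ### Taylor remainders and exponential inequalities -/

section ElementaryBounds

theorem norm_cexp_I_mul_sub_taylor_two {x : ℝ} (hx : |x| ≤ 1) :
    ‖Complex.exp (Complex.I * x) - 1 - Complex.I * x‖ ≤ x ^ 2 := by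
  have hn : ‖Complex.I * (x : ℂ)‖ = |x| := by simp
  have h := Complex.exp_bound (x := Complex.I * x) (by rw [hn]; exact hx) (n := 2) (by norm_num)
  rw [hn] at h
  simp only [Finset.sum_range_succ, Finset.sum_range_zero, Nat.factorial] at h
  norm_num at h
  rw [sub_sub]
  refine h.trans ?_
  nlinarith [sq_nonneg x]

theorem norm_cexp_I_mul_sub_taylor_three {x : ℝ} (hx : |x| ≤ 1) :
    ‖Complex.exp (Complex.I * x) - 1 - Complex.I * x + (x ^ 2 / 2 : ℝ)‖ ≤ |x| ^ 3 := by
  have hn : ‖Complex.I * (x : ℂ)‖ = |x| := by simp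
  have h := Complex.exp_bound (x := Complex.I * x) (by rw [hn]; exact hx) (n := 3) (by norm_num)
  rw [hn] at h
  have h2 : Complex.exp (Complex.I * x) - 1 - Complex.I * x + (x ^ 2 / 2 : ℝ)
      = Complex.exp (Complex.I * x)
        - ∑ m ∈ Finset.range 3, (Complex.I * (x : ℂ)) ^ m / (m.factorial : ℂ) := by
    simp only [Finset.sum_range_succ, Finset.sum_range_zero, Nat.factorial, mul_pow,
      Complex.I_sq]
    push_cast
    ring
  rw [h2]
  refine h.trans (mul_le_of_le_one_right (by positivity) ?_)
  norm_num [Nat.factorial]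

theorem cos_sub_one_le_neg_sq_div_four {x : ℝ} (hx : |x| ≤ 1) :
    Real.cos x - 1 ≤ -(x ^ 2 / 4) := by
  have h := (abs_le.1 (Real.cos_bound hx)).2
  have h2 : |x| ^ 4 = x ^ 2 * x ^ 2 := by rw [← sq_abs x]; ring
  have h3 : x ^ 2 ≤ 1 := by rw [← sq_abs]; exact pow_le_one₀ (abs_nonneg x) hx
  nlinarith [sq_nonneg x]

theorem abs_cos_sub_one_le (x : ℝ) : |Real.cos x - 1| ≤ x ^ 2 / 2 := by
  rw [abs_sub_comm, abs_of_nonneg (by linarith [Real.cos_le_one x])]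
  linarith [Real.one_sub_sq_div_two_le_cos (x := x)]

theorem abs_cos_sub_taylor_le {x : ℝ} (hx : |x| ≤ 1) :
    |Real.cos x - 1 + x ^ 2 / 2| ≤ |x| ^ 3 := by
  have h := Real.cos_bound hx
  rw [show Real.cos x - 1 + x ^ 2 / 2 = Real.cos x - (1 - x ^ 2 / 2) by ring]
  refine h.trans ?_
  have h3 : |x| ^ 4 ≤ |x| ^ 3 := pow_le_pow_of_le_one (abs_nonneg x) hx (by norm_num)
  nlinarith [pow_nonneg (abs_nonneg x) 3]

theorem abs_sin_sub_self_le {x : ℝ} (hx : |x| ≤ 1) : |Real.sin x - x| ≤ |x| ^ 3 := by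
  have h := Real.sin_bound hx
  have h1 : Real.sin x - x = (Real.sin x - (x - x ^ 3 / 6)) + -(x ^ 3 / 6) := by ring
  have h3 : |x| ^ 5 ≤ |x| ^ 3 := pow_le_pow_of_le_one (abs_nonneg x) hx (by norm_num)
  have h4 : |-(x ^ 3 / 6)| = |x| ^ 3 / 6 := by
    rw [abs_neg, abs_div, abs_pow, abs_of_pos (by norm_num : (0 : ℝ) < 6)]
  rw [h1]
  refine (abs_add_le _ _).trans ?_
  rw [h4]
  nlinarith [pow_nonneg (abs_nonneg x) 3]

/-- Mean value inequality on a half-plane, which is convex. A negative `r` retains exponential decay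
in the difference. -/
theorem norm_cexp_sub_cexp_le {a b : ℂ} {r : ℝ} (ha : a.re ≤ r) (hb : b.re ≤ r) :
    ‖Complex.exp a - Complex.exp b‖ ≤ Real.exp r * ‖a - b‖ := by
  refine Convex.norm_image_sub_le_of_norm_deriv_le (𝕜 := ℂ) (s := {z : ℂ | z.re ≤ r})
    (fun z _ => Complex.differentiableAt_exp) (fun z hz => ?_) (convex_halfSpace_re_le r) hb ha
  rw [Complex.deriv_exp, Complex.norm_exp]
  exact Real.exp_le_exp.2 hz

/-- The fourth power covers a cubic error term, through `|x| ≤ 1 + x²`, and leaves one factor over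
for the integrable weight `(1 + x²)⁻¹`. -/
theorem exists_pow_four_mul_exp_neg_le {m : ℝ} (hm : 0 < m) :
    ∃ C, 0 < C ∧ ∀ x : ℝ, (1 + x ^ 2) ^ 4 * Real.exp (-(m * x ^ 2 / 4)) ≤ C := by
  -- The constant comes from `y⁴/4! ≤ exp y` at `y = (m/4)(1 + x²)`.
  refine ⟨24 * (4 / m) ^ 4 * Real.exp (m / 4), by positivity, fun x => ?_⟩
  have h := Real.pow_div_factorial_le_exp (m / 4 * (1 + x ^ 2)) (by positivity) 4
  have h1 : Real.exp (m / 4 * (1 + x ^ 2)) * Real.exp (-(m * x ^ 2 / 4)) = Real.exp (m / 4) := by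
    rw [← Real.exp_add]; ring_nf
  have h2 : (1 + x ^ 2) ^ 4
      = 24 * (4 / m) ^ 4 * ((m / 4 * (1 + x ^ 2)) ^ 4 / (Nat.factorial 4 : ℕ)) := by
    norm_num [Nat.factorial]
    field_simp
  rw [← h1, h2]
  calc _ ≤ 24 * (4 / m) ^ 4 * Real.exp (m / 4 * (1 + x ^ 2)) * Real.exp (-(m * x ^ 2 / 4)) := by
        gcongr
    _ = _ := by ring

end ElementaryBounds

/-! ### Expansion of the cumulant and of its even and odd parts in `v` -/

section Cumulant

open Filter Set

/-- A pair of continuous integrable functions, bounded by `M` and orthogonal in `L²`. -/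
structure BoundedKernelPair (p q : ℝ → ℝ) (M : ℝ) : Prop where
  continuous_fst : Continuous p
  continuous_snd : Continuous q
  integrable_fst : Integrable p
  integrable_snd : Integrable q
  pos : 0 < M
  abs_fst_le : ∀ s, |p s| ≤ M
  abs_snd_le : ∀ s, |q s| ≤ M
  orthogonal : ∫ s, p s * q s = 0

/-- The logarithm of the characteristic function at `(u, v)` of the centred and rescaled Poisson
integrals of `p` and `q`, with intensity `ε⁻²`. -/
noncomputable def cumulant (p q : ℝ → ℝ) (ε u v : ℝ) : ℂ :=
  ((ε ^ 2)⁻¹ : ℝ) * ∫ s, (Complex.exp (Complex.I * (ε * (u * p s + v * q s) : ℝ)) - 1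
    - Complex.I * (ε * (u * p s + v * q s) : ℝ))

namespace BoundedKernelPair

variable {p q : ℝ → ℝ} {M : ℝ}

theorem integrable_mul_of_bounded {f h : ℝ → ℝ} {C : ℝ} (hf : Integrable f) (hh : Continuous h)
    (hb : ∀ s, |h s| ≤ C) : Integrable fun s => f s * h s :=
  hf.mul_bdd hh.aestronglyMeasurable (Eventually.of_forall hb)

theorem integrable_sq_fst (H : BoundedKernelPair p q M) : Integrable fun s => p s ^ 2 := by
  simp_rw [pow_two]
  exact integrable_mul_of_bounded H.integrable_fst H.continuous_fst H.abs_fst_le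

theorem integrable_sq_snd (H : BoundedKernelPair p q M) : Integrable fun s => q s ^ 2 := by
  simp_rw [pow_two]
  exact integrable_mul_of_bounded H.integrable_snd H.continuous_snd H.abs_snd_le

theorem integrable_mul (H : BoundedKernelPair p q M) : Integrable fun s => p s * q s :=
  integrable_mul_of_bounded H.integrable_fst H.continuous_snd H.abs_snd_le

theorem norm_integral_le (H : BoundedKernelPair p q M) {φ : ℝ → ℂ} {c₁ c₂ : ℝ}
    (h : ∀ s, ‖φ s‖ ≤ c₁ * p s ^ 2 + c₂ * q s ^ 2) :
    ‖∫ s, φ s‖ ≤ c₁ * (∫ s, p s ^ 2) + c₂ * ∫ s, q s ^ 2 := by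
  refine (norm_integral_le_of_norm_le ((H.integrable_sq_fst.const_mul c₁).add
    (H.integrable_sq_snd.const_mul c₂)) (Eventually.of_forall h)).trans_eq ?_
  simp only [Pi.add_apply]
  rw [integral_add (H.integrable_sq_fst.const_mul c₁) (H.integrable_sq_snd.const_mul c₂),
    integral_const_mul, integral_const_mul]

theorem integral_sq_linear (H : BoundedKernelPair p q M) (ε u v : ℝ) :
    ∫ s, (ε * (u * p s + v * q s)) ^ 2
      = ε ^ 2 * (u ^ 2 * (∫ s, p s ^ 2) + v ^ 2 * ∫ s, q s ^ 2) := by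
  have h : ∀ s, (ε * (u * p s + v * q s)) ^ 2
      = ε ^ 2 * u ^ 2 * p s ^ 2 + ε ^ 2 * v ^ 2 * q s ^ 2 + 2 * ε ^ 2 * u * v * (p s * q s) := by
    intro s; ring
  have i : Integrable fun s => ε ^ 2 * u ^ 2 * p s ^ 2 + ε ^ 2 * v ^ 2 * q s ^ 2 :=
    (H.integrable_sq_fst.const_mul _).add (H.integrable_sq_snd.const_mul _)
  simp_rw [h]
  rw [integral_add i (H.integrable_mul.const_mul _),
    integral_add (H.integrable_sq_fst.const_mul _) (H.integrable_sq_snd.const_mul _),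
    integral_const_mul, integral_const_mul, integral_const_mul, H.orthogonal]
  ring

theorem integrable_sq_linear (H : BoundedKernelPair p q M) (ε u v : ℝ) :
    Integrable fun s => (ε * (u * p s + v * q s)) ^ 2 := by
  have h : ∀ s, (ε * (u * p s + v * q s)) ^ 2
      = ε ^ 2 * u ^ 2 * p s ^ 2 + ε ^ 2 * v ^ 2 * q s ^ 2 + 2 * ε ^ 2 * u * v * (p s * q s) := by
    intro s; ring
  simp_rw [h]
  exact ((H.integrable_sq_fst.const_mul _).add (H.integrable_sq_snd.const_mul _)).add
    (H.integrable_mul.const_mul _)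

theorem integrable_linear (H : BoundedKernelPair p q M) (ε u v : ℝ) :
    Integrable fun s => ε * (u * p s + v * q s) :=
  ((H.integrable_fst.const_mul u).add (H.integrable_snd.const_mul v)).const_mul ε

theorem integrable_cumulant_integrand (H : BoundedKernelPair p q M) (ε u v : ℝ) :
    Integrable fun s => Complex.exp (Complex.I * (ε * (u * p s + v * q s) : ℝ)) - 1
      - Complex.I * (ε * (u * p s + v * q s) : ℝ) := by
  have hp := H.continuous_fst
  have hq := H.continuous_snd
  refine ((H.integrable_linear ε u v).norm.const_mul 2).mono'
    (Continuous.aestronglyMeasurable (by fun_prop)) (Eventually.of_forall fun s => ?_)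
  refine (norm_sub_le _ _).trans ?_
  rw [two_mul]
  refine add_le_add Real.norm_exp_I_mul_ofReal_sub_one_le ?_
  rw [norm_mul, Complex.norm_I, one_mul, Complex.norm_real]

theorem abs_scaled_le {f : ℝ → ℝ} (hb : ∀ s, |f s| ≤ M) {ε u : ℝ} (hε : 0 < ε)
    (hu : ε * |u| * (2 * M) ≤ 1) (s : ℝ) : |ε * u * f s| ≤ 1 / 2 := by
  rw [abs_mul, abs_mul, abs_of_pos hε]
  have := mul_le_mul_of_nonneg_left (hb s) (by positivity : 0 ≤ ε * |u|)
  linarith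

theorem abs_linear_le_one (H : BoundedKernelPair p q M) {ε u v : ℝ} (hε : 0 < ε)
    (hu : ε * |u| * (2 * M) ≤ 1) (hv : ε * |v| * (2 * M) ≤ 1) (s : ℝ) :
    |ε * (u * p s + v * q s)| ≤ 1 := by
  have h1 := abs_scaled_le H.abs_fst_le hε hu s
  have h2 := abs_scaled_le H.abs_snd_le hε hv s
  rw [show ε * (u * p s + v * q s) = ε * u * p s + ε * v * q s by ring]
  exact (abs_add_le _ _).trans (by linarith)

theorem abs_cube_scaled_le {f : ℝ → ℝ} (hb : ∀ s, |f s| ≤ M) {ε : ℝ} (hε : 0 < ε) (u s : ℝ) :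
    |ε * u * f s| ^ 3 ≤ ε ^ 3 * |u| ^ 3 * M * f s ^ 2 := by
  rw [abs_mul, abs_mul, abs_of_pos hε, ← sq_abs (f s)]
  calc (ε * |u| * |f s|) ^ 3 = ε ^ 3 * |u| ^ 3 * |f s| ^ 2 * |f s| := by ring
    _ ≤ ε ^ 3 * |u| ^ 3 * |f s| ^ 2 * M := by gcongr; exact hb s
    _ = _ := by ring

/-- Gaussian approximation of the cumulant. -/
theorem norm_cumulant_add_le (H : BoundedKernelPair p q M) {ε u v : ℝ} (hε : 0 < ε)
    (hu : ε * |u| * (2 * M) ≤ 1) (hv : ε * |v| * (2 * M) ≤ 1) :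
    ‖cumulant p q ε u v + (((∫ s, p s ^ 2) * u ^ 2 + (∫ s, q s ^ 2) * v ^ 2) / 2 : ℝ)‖
      ≤ ε * (4 * M * (|u| ^ 3 * (∫ s, p s ^ 2) + |v| ^ 3 * ∫ s, q s ^ 2)) := by
  have hε2 : (ε ^ 2)⁻¹ * ε ^ 2 = 1 := inv_mul_cancel₀ (by positivity)
  -- By orthogonality of `p` and `q` the quadratic Taylor term integrates exactly to the Gaussian
  -- exponent, so only the third-order remainder is left. The constant 4 below comes from `(a + b)³
  -- ≤ 4(a³ + b³)`.
  have heq : cumulant p q ε u v + (((∫ s, p s ^ 2) * u ^ 2 + (∫ s, q s ^ 2) * v ^ 2) / 2 : ℝ)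
      = ((ε ^ 2)⁻¹ : ℝ) * ∫ s, (Complex.exp (Complex.I * (ε * (u * p s + v * q s) : ℝ)) - 1
        - Complex.I * (ε * (u * p s + v * q s) : ℝ)
        + ((ε * (u * p s + v * q s)) ^ 2 / 2 : ℝ)) := by
    have i : Integrable fun s => (((ε * (u * p s + v * q s)) ^ 2 / 2 : ℝ) : ℂ) :=
      ((H.integrable_sq_linear ε u v).div_const 2).ofReal
    rw [integral_add (H.integrable_cumulant_integrand ε u v) i, mul_add, cumulant,
      integral_complex_ofReal, integral_div, H.integral_sq_linear, ← Complex.ofReal_mul]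
    congr 2
    linear_combination (-((∫ s, p s ^ 2) * u ^ 2 + (∫ s, q s ^ 2) * v ^ 2) / 2) * hε2
  rw [heq, norm_mul, Complex.norm_real, Real.norm_of_nonneg (by positivity)]
  have hb := H.norm_integral_le
    (φ := fun s => Complex.exp (Complex.I * (ε * (u * p s + v * q s) : ℝ)) - 1
        - Complex.I * (ε * (u * p s + v * q s) : ℝ) + ((ε * (u * p s + v * q s)) ^ 2 / 2 : ℝ))
    (c₁ := 4 * ε ^ 3 * |u| ^ 3 * M) (c₂ := 4 * ε ^ 3 * |v| ^ 3 * M) (fun s => by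
      refine (norm_cexp_I_mul_sub_taylor_three (H.abs_linear_le_one hε hu hv s)).trans ?_
      rw [show ε * (u * p s + v * q s) = ε * u * p s + ε * v * q s by ring]
      have h1 := abs_cube_scaled_le H.abs_fst_le hε u s
      have h2 := abs_cube_scaled_le H.abs_snd_le hε v s
      have h3 : |ε * u * p s + ε * v * q s| ^ 3 ≤ (|ε * u * p s| + |ε * v * q s|) ^ 3 := by
        gcongr
        exact abs_add_le _ _
      have h4 : (|ε * u * p s| + |ε * v * q s|) ^ 3
          ≤ 4 * (|ε * u * p s| ^ 3 + |ε * v * q s| ^ 3) :=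
        (add_pow_le (abs_nonneg _) (abs_nonneg _) 3).trans_eq (by norm_num)
      linarith)
  calc (ε ^ 2)⁻¹ * _ ≤ (ε ^ 2)⁻¹ * (4 * ε ^ 3 * |u| ^ 3 * M * (∫ s, p s ^ 2)
        + 4 * ε ^ 3 * |v| ^ 3 * M * ∫ s, q s ^ 2) := by gcongr
    _ = _ := by
      linear_combination (4 * M * (|u| ^ 3 * (∫ s, p s ^ 2) + |v| ^ 3 * ∫ s, q s ^ 2)) * ε * hε2

theorem cumulant_re (H : BoundedKernelPair p q M) (ε u v : ℝ) :
    (cumulant p q ε u v).re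
      = (ε ^ 2)⁻¹ * ∫ s, (Real.cos (ε * (u * p s + v * q s)) - 1) := by
  rw [cumulant, Complex.re_ofReal_mul, ← RCLike.re_eq_complex_re,
    ← integral_re (H.integrable_cumulant_integrand ε u v)]
  congr 2
  funext s
  rw [RCLike.re_eq_complex_re, mul_comm Complex.I, Complex.sub_re, Complex.sub_re,
    Complex.exp_ofReal_mul_I_re]
  simp

theorem cumulant_re_nonpos (H : BoundedKernelPair p q M) (ε u v : ℝ) :
    (cumulant p q ε u v).re ≤ 0 := by
  rw [H.cumulant_re]
  refine mul_nonpos_of_nonneg_of_nonpos (by positivity) (integral_nonpos fun s => ?_)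
  simpa using Real.cos_le_one _

/-- In this range of frequencies the argument of the cosine is at most one in absolute value, so
`cos x - 1 ≤ -x²/4` applies. This gives a Gaussian decay of the characteristic function that is
uniform in `ε`. -/
theorem cumulant_re_le (H : BoundedKernelPair p q M) {ε u v : ℝ} (hε : 0 < ε)
    (hu : ε * |u| * (2 * M) ≤ 1) (hv : ε * |v| * (2 * M) ≤ 1) :
    (cumulant p q ε u v).re
      ≤ -(((∫ s, p s ^ 2) * u ^ 2 + (∫ s, q s ^ 2) * v ^ 2) / 4) := by
  have hε2 : (ε ^ 2)⁻¹ * ε ^ 2 = 1 := inv_mul_cancel₀ (by positivity)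
  rw [H.cumulant_re]
  have hint : Integrable fun s => Real.cos (ε * (u * p s + v * q s)) - 1 := by
    have h1 := (H.integrable_cumulant_integrand ε u v).re
    refine h1.congr (Eventually.of_forall fun s => ?_)
    simp only
    rw [RCLike.re_eq_complex_re, mul_comm Complex.I, Complex.sub_re, Complex.sub_re,
      Complex.exp_ofReal_mul_I_re]
    simp
  have h2 : ∫ s, (Real.cos (ε * (u * p s + v * q s)) - 1)
      ≤ ∫ s, -((ε * (u * p s + v * q s)) ^ 2 / 4) :=
    integral_mono hint ((H.integrable_sq_linear ε u v).div_const 4).neg fun s =>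
      cos_sub_one_le_neg_sq_div_four (H.abs_linear_le_one hε hu hv s)
  rw [integral_neg, integral_div, H.integral_sq_linear] at h2
  refine (mul_le_mul_of_nonneg_left h2 (by positivity)).trans_eq ?_
  linear_combination (-((∫ s, p s ^ 2) * u ^ 2 + (∫ s, q s ^ 2) * v ^ 2) / 4) * hε2

/-- The even part in `v` of the cumulant. -/
theorem cumulant_even_part (H : BoundedKernelPair p q M) (ε u v : ℝ) :
    (cumulant p q ε u v + cumulant p q ε u (-v)) / 2 - cumulant p q ε u 0
      = ((ε ^ 2)⁻¹ : ℝ) * ∫ s, Complex.exp (Complex.I * (ε * u * p s : ℝ))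
          * (Real.cos (ε * v * q s) - 1 : ℝ) := by
  have i1 := H.integrable_cumulant_integrand ε u v
  have i2 := H.integrable_cumulant_integrand ε u (-v)
  have i3 := H.integrable_cumulant_integrand ε u 0
  have : ∀ s, Complex.exp (Complex.I * (ε * u * p s : ℝ)) * (Real.cos (ε * v * q s) - 1 : ℝ)
      = ((Complex.exp (Complex.I * (ε * (u * p s + v * q s) : ℝ)) - 1
          - Complex.I * (ε * (u * p s + v * q s) : ℝ))
        + (Complex.exp (Complex.I * (ε * (u * p s + -v * q s) : ℝ)) - 1
          - Complex.I * (ε * (u * p s + -v * q s) : ℝ))) / 2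
        - (Complex.exp (Complex.I * (ε * (u * p s + 0 * q s) : ℝ)) - 1
          - Complex.I * (ε * (u * p s + 0 * q s) : ℝ)) := by
    intro s
    have e1 : Complex.exp (Complex.I * (ε * (u * p s + v * q s) : ℝ))
        = Complex.exp (Complex.I * (ε * u * p s : ℝ))
          * Complex.exp ((ε * v * q s : ℝ) * Complex.I) := by
      rw [← Complex.exp_add]; push_cast; ring_nf
    have e2 : Complex.exp (Complex.I * (ε * (u * p s + -v * q s) : ℝ))
        = Complex.exp (Complex.I * (ε * u * p s : ℝ))
          * Complex.exp (-(ε * v * q s : ℝ) * Complex.I) := by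
      rw [← Complex.exp_add]; push_cast; ring_nf
    have e3 : ε * (u * p s + 0 * q s) = ε * u * p s := by ring
    rw [e1, e2, e3]
    push_cast
    rw [Complex.cos]
    ring
  have i4 : Integrable fun s => ((Complex.exp (Complex.I * (ε * (u * p s + v * q s) : ℝ)) - 1
          - Complex.I * (ε * (u * p s + v * q s) : ℝ))
        + (Complex.exp (Complex.I * (ε * (u * p s + -v * q s) : ℝ)) - 1
          - Complex.I * (ε * (u * p s + -v * q s) : ℝ))) / 2 := (i1.add i2).div_const 2
  simp_rw [this]
  rw [integral_sub i4 i3, integral_div, integral_add i1 i2]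
  simp only [cumulant]
  ring

/-- The odd part in `v` of the cumulant. -/
theorem cumulant_odd_part (H : BoundedKernelPair p q M) (ε u v : ℝ) :
    (cumulant p q ε u v - cumulant p q ε u (-v)) / 2
      = ((ε ^ 2)⁻¹ : ℝ) * ∫ s, Complex.I * (Complex.exp (Complex.I * (ε * u * p s : ℝ))
          * (Real.sin (ε * v * q s) : ℝ) - (ε * v * q s : ℝ)) := by
  have i1 := H.integrable_cumulant_integrand ε u v
  have i2 := H.integrable_cumulant_integrand ε u (-v)
  have : ∀ s, Complex.I * (Complex.exp (Complex.I * (ε * u * p s : ℝ))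
          * (Real.sin (ε * v * q s) : ℝ) - (ε * v * q s : ℝ))
      = ((Complex.exp (Complex.I * (ε * (u * p s + v * q s) : ℝ)) - 1
          - Complex.I * (ε * (u * p s + v * q s) : ℝ))
        - (Complex.exp (Complex.I * (ε * (u * p s + -v * q s) : ℝ)) - 1
          - Complex.I * (ε * (u * p s + -v * q s) : ℝ))) / 2 := by
    intro s
    have e1 : Complex.exp (Complex.I * (ε * (u * p s + v * q s) : ℝ))
        = Complex.exp (Complex.I * (ε * u * p s : ℝ))
          * Complex.exp ((ε * v * q s : ℝ) * Complex.I) := by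
      rw [← Complex.exp_add]; push_cast; ring_nf
    have e2 : Complex.exp (Complex.I * (ε * (u * p s + -v * q s) : ℝ))
        = Complex.exp (Complex.I * (ε * u * p s : ℝ))
          * Complex.exp (-(ε * v * q s : ℝ) * Complex.I) := by
      rw [← Complex.exp_add]; push_cast; ring_nf
    rw [e1, e2]
    push_cast
    rw [Complex.sin]
    linear_combination (Complex.exp (Complex.I * (ε * u * p s))
      * (Complex.exp (-(ε * v * q s) * Complex.I) - Complex.exp (ε * v * q s * Complex.I)) / 2)
        * Complex.I_sq
  simp_rw [this]
  rw [integral_div, integral_sub i1 i2]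
  simp only [cumulant]
  ring

theorem norm_cexp_I_mul_ofReal (x : ℝ) : ‖Complex.exp (Complex.I * x)‖ = 1 := by
  rw [mul_comm, Complex.norm_exp_ofReal_mul_I]

/-- The integrand `exp(iεup)(cos(εvq) - 1)` differs from `-(εvq)²/2` by `(exp(iεup) - 1)(cos(εvq) -
1)`, of size `ε|u|M (εvq)²`, and by the Taylor remainder of the cosine, of size `|εvq|³`. Both
retain the factor `v²`, needed to survive the division by `v²`. The factor `|u|` accounts for the
term `a₃|u|` of the theorem. -/
theorem norm_cumulant_even_part_add_le (H : BoundedKernelPair p q M) {ε u v : ℝ} (hε : 0 < ε)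
    (hv : ε * |v| * (2 * M) ≤ 1) :
    ‖(cumulant p q ε u v + cumulant p q ε u (-v)) / 2 - cumulant p q ε u 0
        + ((∫ s, q s ^ 2) * v ^ 2 / 2 : ℝ)‖
      ≤ ε * v ^ 2 * (M * (∫ s, q s ^ 2) * (|u| + |v|)) := by
  have hε2 : (ε ^ 2)⁻¹ * ε ^ 2 = 1 := inv_mul_cancel₀ (by positivity)
  have hp := H.continuous_fst
  have hq := H.continuous_snd
  have i0 : Integrable fun s => (ε * v * q s) ^ 2 / 2 := by
    simp_rw [mul_pow]
    exact (H.integrable_sq_snd.const_mul _).div_const 2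
  have hi : Integrable fun s => Complex.exp (Complex.I * (ε * u * p s : ℝ))
          * (Real.cos (ε * v * q s) - 1 : ℝ) := by
    refine i0.mono' (Continuous.aestronglyMeasurable (by fun_prop))
      (Eventually.of_forall fun s => ?_)
    rw [norm_mul, norm_cexp_I_mul_ofReal, one_mul, Complex.norm_real]
    exact abs_cos_sub_one_le _
  have heq : (cumulant p q ε u v + cumulant p q ε u (-v)) / 2 - cumulant p q ε u 0
        + ((∫ s, q s ^ 2) * v ^ 2 / 2 : ℝ)
      = ((ε ^ 2)⁻¹ : ℝ) * ∫ s, (Complex.exp (Complex.I * (ε * u * p s : ℝ))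
          * (Real.cos (ε * v * q s) - 1 : ℝ) + ((ε * v * q s) ^ 2 / 2 : ℝ)) := by
    have i1 : Integrable fun s => (((ε * v * q s) ^ 2 / 2 : ℝ) : ℂ) := i0.ofReal
    rw [H.cumulant_even_part, integral_add hi i1, mul_add, integral_complex_ofReal,
      integral_div, ← Complex.ofReal_mul]
    simp_rw [mul_pow]
    rw [integral_const_mul]
    congr 2
    linear_combination (-((∫ s, q s ^ 2) * v ^ 2) / 2) * hε2
  rw [heq, norm_mul, Complex.norm_real, Real.norm_of_nonneg (by positivity)]
  have hb := H.norm_integral_le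
    (φ := fun s => Complex.exp (Complex.I * (ε * u * p s : ℝ))
          * (Real.cos (ε * v * q s) - 1 : ℝ) + ((ε * v * q s) ^ 2 / 2 : ℝ))
    (c₁ := 0) (c₂ := ε ^ 3 * v ^ 2 * M * (|u| + |v|)) (fun s => by
      have h1 : Complex.exp (Complex.I * (ε * u * p s : ℝ))
          * (Real.cos (ε * v * q s) - 1 : ℝ) + ((ε * v * q s) ^ 2 / 2 : ℝ)
          = (Complex.exp (Complex.I * (ε * u * p s : ℝ)) - 1) * (Real.cos (ε * v * q s) - 1 : ℝ)
            + (Real.cos (ε * v * q s) - 1 + (ε * v * q s) ^ 2 / 2 : ℝ) := by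
        push_cast; ring
      have h2 := abs_scaled_le H.abs_snd_le hε hv s
      rw [h1, zero_mul, zero_add]
      refine (norm_add_le _ _).trans ?_
      rw [norm_mul, Complex.norm_real, Complex.norm_real, Real.norm_eq_abs, Real.norm_eq_abs]
      have h3 : ‖Complex.exp (Complex.I * (ε * u * p s : ℝ)) - 1‖ ≤ ε * |u| * M := by
        refine Real.norm_exp_I_mul_ofReal_sub_one_le.trans ?_
        rw [Real.norm_eq_abs, abs_mul, abs_mul, abs_of_pos hε]
        exact mul_le_mul_of_nonneg_left (H.abs_fst_le s) (by positivity)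
      have h4 := abs_cos_sub_one_le (ε * v * q s)
      have h5 := (abs_cos_sub_taylor_le (x := ε * v * q s) (by linarith)).trans
        (abs_cube_scaled_le H.abs_snd_le hε v s)
      have h6 : |v| ^ 3 = v ^ 2 * |v| := by rw [← sq_abs v]; ring
      have h7 : (0 : ℝ) ≤ ε * |u| * M := by have := H.pos; positivity
      have h8 := mul_le_mul h3 h4 (abs_nonneg _) h7
      rw [h6] at h5
      have h9 : 0 ≤ ε ^ 3 * v ^ 2 * M * |u| * q s ^ 2 := by have := H.pos; positivity
      calc _ ≤ ε * |u| * M * ((ε * v * q s) ^ 2 / 2) + ε ^ 3 * (v ^ 2 * |v|) * M * q s ^ 2 :=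
            add_le_add h8 h5
        _ = ε ^ 3 * v ^ 2 * M * |u| * q s ^ 2 / 2 + ε ^ 3 * (v ^ 2 * |v|) * M * q s ^ 2 := by ring
        _ ≤ ε ^ 3 * v ^ 2 * M * |u| * q s ^ 2 + ε ^ 3 * (v ^ 2 * |v|) * M * q s ^ 2 := by linarith
        _ = _ := by ring)
  rw [zero_mul, zero_add] at hb
  refine (mul_le_mul_of_nonneg_left hb (by positivity)).trans_eq ?_
  linear_combination (ε * v ^ 2 * (M * (∫ s, q s ^ 2) * (|u| + |v|))) * hε2

/-- Since `|εup| ≤ 1/2`, the cosine of `εup` is nonnegative and the real part of the integrand,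
`cos(εup)(cos(εvq) - 1)`, is nonpositive. It allows exponentials of the even part to be compared
with Lipschitz constant one. -/
theorem cumulant_even_part_re_nonpos (H : BoundedKernelPair p q M) {ε u v : ℝ} (hε : 0 < ε)
    (hu : ε * |u| * (2 * M) ≤ 1) :
    ((cumulant p q ε u v + cumulant p q ε u (-v)) / 2 - cumulant p q ε u 0).re ≤ 0 := by
  have hp := H.continuous_fst
  have hq := H.continuous_snd
  have i0 : Integrable fun s => (ε * v * q s) ^ 2 / 2 := by
    simp_rw [mul_pow]
    exact (H.integrable_sq_snd.const_mul _).div_const 2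
  have hi : Integrable fun s => Complex.exp (Complex.I * (ε * u * p s : ℝ))
          * (Real.cos (ε * v * q s) - 1 : ℝ) := by
    refine i0.mono' (Continuous.aestronglyMeasurable (by fun_prop))
      (Eventually.of_forall fun s => ?_)
    rw [norm_mul, norm_cexp_I_mul_ofReal, one_mul, Complex.norm_real]
    exact abs_cos_sub_one_le _
  rw [H.cumulant_even_part, Complex.re_ofReal_mul, ← RCLike.re_eq_complex_re, ← integral_re hi]
  refine mul_nonpos_of_nonneg_of_nonpos (by positivity) (integral_nonpos fun s => ?_)
  simp only [Pi.zero_apply]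
  rw [RCLike.re_eq_complex_re, Complex.re_mul_ofReal, mul_comm Complex.I,
    Complex.exp_ofReal_mul_I_re]
  have h1 := abs_le.1 (abs_scaled_le H.abs_fst_le hε hu s)
  have h2 : 0 ≤ Real.cos (ε * u * p s) :=
    Real.cos_nonneg_of_mem_Icc ⟨by linarith [Real.pi_gt_three], by linarith [Real.pi_gt_three]⟩
  exact mul_nonpos_of_nonneg_of_nonpos h2 (by linarith [Real.cos_le_one (ε * v * q s)])

/-- The quadratic term of the integrand is `-(εup)(εvq)`, which integrates to zero by orthogonality.
Hence the odd part begins with cubic terms and gains a factor `ε`. -/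
theorem norm_cumulant_odd_part_le (H : BoundedKernelPair p q M) {ε u v : ℝ} (hε : 0 < ε)
    (hu : ε * |u| * (2 * M) ≤ 1) (hv : ε * |v| * (2 * M) ≤ 1) :
    ‖(cumulant p q ε u v - cumulant p q ε u (-v)) / 2‖
      ≤ ε * |v| * (M * (u ^ 2 * (∫ s, p s ^ 2) + 2 * v ^ 2 * ∫ s, q s ^ 2)) := by
  have hε2 : (ε ^ 2)⁻¹ * ε ^ 2 = 1 := inv_mul_cancel₀ (by positivity)
  have hp := H.continuous_fst
  have hq := H.continuous_snd
  have i0 : Integrable fun s => (((ε * u * p s) * (ε * v * q s) : ℝ) : ℂ) := by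
    have : ∀ s, (ε * u * p s) * (ε * v * q s) = ε ^ 2 * u * v * (p s * q s) := by intro s; ring
    simp_rw [this]
    exact (H.integrable_mul.const_mul _).ofReal
  have iv : Integrable fun s => ‖ε * v * q s‖ := (H.integrable_snd.const_mul (ε * v)).norm
  have hi : Integrable fun s => Complex.I * (Complex.exp (Complex.I * (ε * u * p s : ℝ))
          * (Real.sin (ε * v * q s) : ℝ) - (ε * v * q s : ℝ)) := by
    refine (iv.const_mul 2).mono' (Continuous.aestronglyMeasurable (by fun_prop))
      (Eventually.of_forall fun s => ?_)
    rw [norm_mul, Complex.norm_I, one_mul]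
    refine (norm_sub_le _ _).trans ?_
    rw [norm_mul, norm_cexp_I_mul_ofReal, one_mul, Complex.norm_real, Complex.norm_real, two_mul]
    exact add_le_add Real.abs_sin_le_abs le_rfl
  have hzero : ∫ s, (((ε * u * p s) * (ε * v * q s) : ℝ) : ℂ) = 0 := by
    have : ∀ s, (ε * u * p s) * (ε * v * q s) = ε ^ 2 * u * v * (p s * q s) := by intro s; ring
    simp_rw [this]
    rw [integral_complex_ofReal, integral_const_mul, H.orthogonal]
    simp
  have heq : (cumulant p q ε u v - cumulant p q ε u (-v)) / 2
      = ((ε ^ 2)⁻¹ : ℝ) * ∫ s, (Complex.I * (Complex.exp (Complex.I * (ε * u * p s : ℝ))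
          * (Real.sin (ε * v * q s) : ℝ) - (ε * v * q s : ℝ))
          + (((ε * u * p s) * (ε * v * q s) : ℝ) : ℂ)) := by
    rw [H.cumulant_odd_part, integral_add hi i0, hzero, add_zero]
  rw [heq, norm_mul, Complex.norm_real, Real.norm_of_nonneg (by positivity)]
  have hb := H.norm_integral_le
    (φ := fun s => Complex.I * (Complex.exp (Complex.I * (ε * u * p s : ℝ))
          * (Real.sin (ε * v * q s) : ℝ) - (ε * v * q s : ℝ))
          + (((ε * u * p s) * (ε * v * q s) : ℝ) : ℂ))
    (c₁ := ε ^ 3 * u ^ 2 * |v| * M) (c₂ := 2 * (ε ^ 3 * |v| ^ 3 * M)) (fun s => by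
      have hy := abs_scaled_le H.abs_fst_le hε hu s
      have hx := abs_scaled_le H.abs_snd_le hε hv s
      have hx3 := abs_cube_scaled_le H.abs_snd_le hε v s
      have hyx : (ε * u * p s) ^ 2 * |ε * v * q s| ≤ ε ^ 3 * u ^ 2 * |v| * M * p s ^ 2 := by
        rw [abs_mul, abs_mul, abs_of_pos hε]
        calc (ε * u * p s) ^ 2 * (ε * |v| * |q s|)
            ≤ (ε * u * p s) ^ 2 * (ε * |v| * M) := by gcongr; exact H.abs_snd_le s
          _ = _ := by ring
      generalize ε * u * p s = y at *
      generalize ε * v * q s = x at *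
      have h1 : Complex.I * (Complex.exp (Complex.I * (y : ℂ)) * (Real.sin x : ℝ) - x)
          + ((y * x : ℝ) : ℂ)
          = Complex.I * ((Complex.exp (Complex.I * y) - 1 - Complex.I * y) * (Real.sin x : ℝ))
            + Complex.I * ((1 + Complex.I * y) * ((Real.sin x - x : ℝ) : ℂ)) := by
        push_cast
        linear_combination (y * x : ℂ) * Complex.I_sq
      rw [h1]
      refine (norm_add_le _ _).trans ?_
      simp only [norm_mul, Complex.norm_I, one_mul, Complex.norm_real, Real.norm_eq_abs]
      have h2 := norm_cexp_I_mul_sub_taylor_two (x := y) (by linarith)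
      have h3 : ‖(1 : ℂ) + Complex.I * y‖ ≤ 2 := by
        refine (norm_add_le _ _).trans ?_
        simp only [norm_one, norm_mul, Complex.norm_I, one_mul, Complex.norm_real,
          Real.norm_eq_abs]
        linarith
      have h4 := abs_sin_sub_self_le (x := x) (by linarith)
      have h5 := mul_le_mul h2 (Real.abs_sin_le_abs (x := x)) (abs_nonneg _) (sq_nonneg y)
      have h6 := mul_le_mul h3 h4 (abs_nonneg _) zero_le_two
      linarith)
  refine (mul_le_mul_of_nonneg_left hb (by positivity)).trans_eq ?_
  have h6 : |v| ^ 3 = v ^ 2 * |v| := by rw [← sq_abs v]; ring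
  rw [h6]
  linear_combination (ε * |v| * (M * (u ^ 2 * (∫ s, p s ^ 2) + 2 * v ^ 2 * ∫ s, q s ^ 2))) * hε2

end BoundedKernelPair

end Cumulant

/-! ### Comparison of the second difference in `v` with its Gaussian limit -/

section FourierEstimate

namespace BoundedKernelPair

variable {p q : ℝ → ℝ} {M : ℝ}

theorem norm_cexp_cumulant_le_one (H : BoundedKernelPair p q M) (ε u v : ℝ) :
    ‖Complex.exp (cumulant p q ε u v)‖ ≤ 1 := by
  rw [Complex.norm_exp]
  exact Real.exp_le_one_iff.2 (H.cumulant_re_nonpos ε u v)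

/-- Both exponents have real part at most `-(m₀u² + m₂v²)/4`, so the error of the cumulant is
multiplied by the corresponding exponential. Each cube keeps the exponential in its own variable;
the other one is bounded by one. -/
theorem norm_cexp_cumulant_sub_gaussian_le (H : BoundedKernelPair p q M) {ε u v : ℝ} (hε : 0 < ε)
    (hu : ε * |u| * (2 * M) ≤ 1) (hv : ε * |v| * (2 * M) ≤ 1) :
    ‖Complex.exp (cumulant p q ε u v)
        - (Real.exp (-(((∫ s, p s ^ 2) * u ^ 2 + (∫ s, q s ^ 2) * v ^ 2) / 2)) : ℝ)‖
      ≤ ε * (4 * M * ((∫ s, p s ^ 2) * (|u| ^ 3 * Real.exp (-((∫ s, p s ^ 2) * u ^ 2 / 4)))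
          + (∫ s, q s ^ 2) * (|v| ^ 3 * Real.exp (-((∫ s, q s ^ 2) * v ^ 2 / 4))))) := by
  have hA := H.norm_cumulant_add_le hε hu hv
  have hR := H.cumulant_re_le hε hu hv
  have hm0 : 0 ≤ ∫ s, p s ^ 2 := integral_nonneg fun s => sq_nonneg _
  have hm2 : 0 ≤ ∫ s, q s ^ 2 := integral_nonneg fun s => sq_nonneg _
  have hM := H.pos
  generalize ∫ s, p s ^ 2 = m₀ at *
  generalize ∫ s, q s ^ 2 = m₂ at *
  have h1 := norm_cexp_sub_cexp_le (a := cumulant p q ε u v)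
    (b := (-((m₀ * u ^ 2 + m₂ * v ^ 2) / 2) : ℝ)) hR (by
      rw [Complex.ofReal_re]; nlinarith [mul_nonneg hm0 (sq_nonneg u), mul_nonneg hm2 (sq_nonneg v)])
  rw [Complex.ofReal_exp]
  refine h1.trans ?_
  rw [Complex.ofReal_neg, sub_neg_eq_add]
  have e0 : Real.exp (-((m₀ * u ^ 2 + m₂ * v ^ 2) / 4))
      = Real.exp (-(m₀ * u ^ 2 / 4)) * Real.exp (-(m₂ * v ^ 2 / 4)) := by
    rw [← Real.exp_add]; ring_nf
  have ea : Real.exp (-(m₀ * u ^ 2 / 4)) ≤ 1 := Real.exp_le_one_iff.2 (by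
    have := mul_nonneg hm0 (sq_nonneg u); linarith)
  have eb : Real.exp (-(m₂ * v ^ 2 / 4)) ≤ 1 := Real.exp_le_one_iff.2 (by
    have := mul_nonneg hm2 (sq_nonneg v); linarith)
  calc _ ≤ Real.exp (-((m₀ * u ^ 2 + m₂ * v ^ 2) / 4))
        * (ε * (4 * M * (|u| ^ 3 * m₀ + |v| ^ 3 * m₂))) := by gcongr
    _ = ε * (4 * M * (m₀ * (|u| ^ 3 * (Real.exp (-(m₀ * u ^ 2 / 4)) * Real.exp (-(m₂ * v ^ 2 / 4))))
        + m₂ * (|v| ^ 3 * (Real.exp (-(m₀ * u ^ 2 / 4)) * Real.exp (-(m₂ * v ^ 2 / 4)))))) := by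
        rw [e0]; ring
    _ ≤ _ := by
        gcongr
        · exact mul_le_of_le_one_right (Real.exp_pos _).le eb
        · exact mul_le_of_le_one_left (Real.exp_pos _).le ea

theorem abs_cube_mul_le {x E C : ℝ} (hE : 0 ≤ E) (h : (1 + x ^ 2) ^ 4 * E ≤ C) :
    |x| ^ 3 * E ≤ C * (1 + x ^ 2)⁻¹ := by
  have h1 : |x| ≤ 1 + x ^ 2 := by
    rw [← sq_abs]; nlinarith [sq_nonneg (|x| - 1), abs_nonneg x]
  rw [← div_eq_mul_inv, le_div_iff₀ (by positivity)]
  calc |x| ^ 3 * E * (1 + x ^ 2) ≤ (1 + x ^ 2) ^ 3 * E * (1 + x ^ 2) := by gcongr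
    _ = (1 + x ^ 2) ^ 4 * E := by ring
    _ ≤ C := h

theorem abs_cube_mul_le' {x E C : ℝ} (hE : 0 ≤ E) (hC : 0 ≤ C) (h : (1 + x ^ 2) ^ 4 * E ≤ C) :
    |x| ^ 3 * E ≤ C :=
  (abs_cube_mul_le hE h).trans (mul_le_of_le_one_right hC
    (inv_le_one_of_one_le₀ (by nlinarith [sq_nonneg x])))

/-- Estimate of the second difference for small frequencies `v`. -/
theorem norm_second_difference_le_of_abs_le_one (H : BoundedKernelPair p q M) {C : ℝ} (hC : 0 < C)
    (hC0 : ∀ x : ℝ, (1 + x ^ 2) ^ 4 * Real.exp (-((∫ s, p s ^ 2) * x ^ 2 / 4)) ≤ C)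
    {ε u v : ℝ} (hε : 0 < ε) (hε1 : ε ≤ 1)
    (hu : ε * |u| * (2 * M) ≤ 1) (hv : ε * |v| * (2 * M) ≤ 1) (hv1 : |v| ≤ 1) :
    ‖Complex.exp (cumulant p q ε u 0)
        - (Complex.exp (cumulant p q ε u v) + Complex.exp (cumulant p q ε u (-v))) / 2
        - (Real.exp (-((∫ s, p s ^ 2) * u ^ 2 / 2))
            * (1 - Real.exp (-((∫ s, q s ^ 2) * v ^ 2 / 2))) : ℝ)‖
      ≤ ε * v ^ 2 * (2 * M * (∫ s, p s ^ 2) * C * (∫ s, q s ^ 2)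
          + M * (∫ s, q s ^ 2) * (1 + |u|)
          + M ^ 2 * ((∫ s, p s ^ 2) + 2 * ∫ s, q s ^ 2) ^ 2 * C) := by
  have hv0 : ε * |(0 : ℝ)| * (2 * M) ≤ 1 := by simp
  have hvn : ε * |-v| * (2 * M) ≤ 1 := by rwa [abs_neg]
  have hG := H.norm_cexp_cumulant_sub_gaussian_le hε hu hv0
  have hE := H.norm_cumulant_even_part_add_le (u := u) hε hv
  have hEre := H.cumulant_even_part_re_nonpos (v := v) hε hu
  have hO := H.norm_cumulant_odd_part_le hε hu hv
  have hRp := H.cumulant_re_le hε hu hv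
  have hRn := H.cumulant_re_le hε hu hvn
  have hF0 := H.norm_cexp_cumulant_le_one ε u 0
  have hm0 : 0 ≤ ∫ s, p s ^ 2 := integral_nonneg fun s => sq_nonneg _
  have hm2 : 0 ≤ ∫ s, q s ^ 2 := integral_nonneg fun s => sq_nonneg _
  have hM := H.pos
  generalize ∫ s, p s ^ 2 = m₀ at *
  generalize ∫ s, q s ^ 2 = m₂ at *
  generalize cumulant p q ε u 0 = F₀ at *
  generalize cumulant p q ε u v = F₁ at *
  generalize cumulant p q ε u (-v) = F₂ at *
  have hu0 : 0 ≤ m₀ * u ^ 2 := mul_nonneg hm0 (sq_nonneg u)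
  have hv2 : 0 ≤ m₂ * v ^ 2 := mul_nonneg hm2 (sq_nonneg v)
  have hvsq : v ^ 2 ≤ 1 := by rw [← sq_abs]; exact pow_le_one₀ (abs_nonneg v) hv1
  set G₀ : ℂ := ((Real.exp (-(m₀ * u ^ 2 / 2)) : ℝ) : ℂ) with hG₀
  set D : ℂ := (F₁ + F₂) / 2 - F₀ with hD
  set L : ℂ := ((-(m₂ * v ^ 2 / 2) : ℝ) : ℂ) with hL
  -- With `D` the even part, `exp F₀ · exp D = exp(F₁/2) exp(F₂/2)`. The mean of `exp F₁` and `exp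
  -- F₂` is therefore `exp F₀ · exp D` plus half the square of `exp(F₁/2) - exp(F₂/2)`. The odd part
  -- thus enters quadratically, and each of the three resulting terms carries a factor `v²`.
  have hdec : Complex.exp F₀ - (Complex.exp F₁ + Complex.exp F₂) / 2
      - (Real.exp (-(m₀ * u ^ 2 / 2)) * (1 - Real.exp (-(m₂ * v ^ 2 / 2))) : ℝ)
      = (Complex.exp F₀ - G₀) * (1 - Complex.exp L)
        + Complex.exp F₀ * (Complex.exp L - Complex.exp D)
        - (Complex.exp (F₁ / 2) - Complex.exp (F₂ / 2)) ^ 2 / 2 := by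
    have e1 : Complex.exp F₁ = Complex.exp (F₁ / 2) ^ 2 := by
      rw [← Complex.exp_nat_mul]; congr 1; push_cast; ring
    have e2 : Complex.exp F₂ = Complex.exp (F₂ / 2) ^ 2 := by
      rw [← Complex.exp_nat_mul]; congr 1; push_cast; ring
    have e3 : Complex.exp F₀ * Complex.exp D = Complex.exp (F₁ / 2) * Complex.exp (F₂ / 2) := by
      rw [← Complex.exp_add, ← Complex.exp_add]; congr 1; rw [hD]; ring
    have e4 : (Real.exp (-(m₀ * u ^ 2 / 2)) * (1 - Real.exp (-(m₂ * v ^ 2 / 2))) : ℝ)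
        = G₀ * (1 - Complex.exp L) := by
      rw [hG₀, hL, ← Complex.ofReal_exp]; push_cast; rfl
    rw [e4, e1, e2]
    linear_combination e3
  have t1 : ‖(Complex.exp F₀ - G₀) * (1 - Complex.exp L)‖
      ≤ ε * v ^ 2 * (2 * M * m₀ * C * m₂) := by
    have h1 : ‖Complex.exp F₀ - G₀‖ ≤ ε * (4 * M * (m₀ * C)) := by
      have h2 : -((m₀ * u ^ 2 + m₂ * 0 ^ 2) / 2) = -(m₀ * u ^ 2 / 2) := by ring
      rw [h2] at hG
      refine hG.trans ?_
      have h3 := abs_cube_mul_le' (Real.exp_pos _).le hC.le (hC0 u)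
      simp only [abs_zero, ne_eq, OfNat.ofNat_ne_zero, not_false_eq_true, zero_pow, zero_mul,
        mul_zero, add_zero]
      gcongr
    have h4 : ‖1 - Complex.exp L‖ ≤ m₂ * v ^ 2 / 2 := by
      have h5 := norm_cexp_sub_cexp_le (a := 0) (b := L) (r := 0) (by simp)
        (by rw [hL, Complex.ofReal_re]; linarith)
      rw [Complex.exp_zero, Real.exp_zero, one_mul, zero_sub, norm_neg, hL, Complex.norm_real,
        Real.norm_eq_abs, abs_neg, abs_of_nonneg (by positivity)] at h5
      exact h5
    rw [norm_mul]
    calc _ ≤ ε * (4 * M * (m₀ * C)) * (m₂ * v ^ 2 / 2) := by gcongr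
      _ = _ := by ring
  have t2 : ‖Complex.exp F₀ * (Complex.exp L - Complex.exp D)‖
      ≤ ε * v ^ 2 * (M * m₂ * (1 + |u|)) := by
    have h5 := norm_cexp_sub_cexp_le (a := L) (b := D) (r := 0)
      (by rw [hL, Complex.ofReal_re]; linarith) hEre
    have h6 : ‖L - D‖ = ‖D + (m₂ * v ^ 2 / 2 : ℝ)‖ := by
      rw [← norm_neg, hL]; congr 1; push_cast; ring
    rw [Real.exp_zero, one_mul, h6] at h5
    rw [norm_mul]
    calc _ ≤ 1 * (ε * v ^ 2 * (M * m₂ * (|u| + |v|))) := by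
          gcongr
          exact h5.trans hE
      _ ≤ 1 * (ε * v ^ 2 * (M * m₂ * (|u| + 1))) := by gcongr
      _ = _ := by ring
  -- The difference of the half exponentials is `exp(-m₀u²/8) · O(ε|v|(1 + u²))`. Its square is
  -- `O(ε²v²)`, the growth in `u` being absorbed by `exp(-m₀u²/4)`, and `ε² ≤ ε`.
  have t3 : ‖(Complex.exp (F₁ / 2) - Complex.exp (F₂ / 2)) ^ 2 / 2‖
      ≤ ε * v ^ 2 * (M ^ 2 * (m₀ + 2 * m₂) ^ 2 * C) := by
    have h5 := norm_cexp_sub_cexp_le (a := F₁ / 2) (b := F₂ / 2) (r := -(m₀ * u ^ 2 / 8))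
      (by rw [Complex.div_ofNat_re]; linarith)
      (by rw [Complex.div_ofNat_re]; rw [neg_sq] at hRn; linarith)
    rw [← sub_div] at h5
    have h6 : u ^ 2 * m₀ + 2 * v ^ 2 * m₂ ≤ (m₀ + 2 * m₂) * (1 + u ^ 2) := by
      nlinarith [mul_nonneg hm2 (sq_nonneg u), mul_le_mul_of_nonneg_left hvsq hm2]
    have h7 : ‖Complex.exp (F₁ / 2) - Complex.exp (F₂ / 2)‖
        ≤ Real.exp (-(m₀ * u ^ 2 / 8)) * (ε * |v| * (M * ((m₀ + 2 * m₂) * (1 + u ^ 2)))) := by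
      refine h5.trans (mul_le_mul_of_nonneg_left (hO.trans ?_) (Real.exp_pos _).le)
      gcongr
    have h8 : Real.exp (-(m₀ * u ^ 2 / 8)) ^ 2 = Real.exp (-(m₀ * u ^ 2 / 4)) := by
      rw [← Real.exp_nat_mul]; congr 1; push_cast; ring
    have h9 : (1 + u ^ 2) ^ 2 * Real.exp (-(m₀ * u ^ 2 / 4)) ≤ C := by
      refine le_trans ?_ (hC0 u)
      gcongr
      · nlinarith [sq_nonneg u]
      · norm_num
    have h10 : ε ^ 2 ≤ ε := by nlinarith
    have hn2 : ‖(2 : ℂ)‖ = 2 := by simp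
    rw [norm_div, norm_pow, hn2]
    calc ‖Complex.exp (F₁ / 2) - Complex.exp (F₂ / 2)‖ ^ 2 / 2
        ≤ ‖Complex.exp (F₁ / 2) - Complex.exp (F₂ / 2)‖ ^ 2 :=
          half_le_self (sq_nonneg _)
      _ ≤ (Real.exp (-(m₀ * u ^ 2 / 8))
            * (ε * |v| * (M * ((m₀ + 2 * m₂) * (1 + u ^ 2))))) ^ 2 := by gcongr
      _ = ε ^ 2 * v ^ 2 * (M ^ 2 * (m₀ + 2 * m₂) ^ 2
            * ((1 + u ^ 2) ^ 2 * Real.exp (-(m₀ * u ^ 2 / 4)))) := by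
          rw [← h8, ← sq_abs v]; ring
      _ ≤ ε * v ^ 2 * (M ^ 2 * (m₀ + 2 * m₂) ^ 2 * C) := by gcongr
  rw [hdec]
  refine (norm_sub_le _ _).trans ((add_le_add (norm_add_le _ _) le_rfl).trans ?_)
  linarith

/-- Estimate of the second difference for intermediate frequencies `v`. -/
theorem norm_second_difference_le (H : BoundedKernelPair p q M) {C : ℝ} (hC : 0 < C)
    (hC0 : ∀ x : ℝ, (1 + x ^ 2) ^ 4 * Real.exp (-((∫ s, p s ^ 2) * x ^ 2 / 4)) ≤ C)
    {ε u v : ℝ} (hε : 0 < ε)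
    (hu : ε * |u| * (2 * M) ≤ 1) (hv : ε * |v| * (2 * M) ≤ 1) :
    ‖Complex.exp (cumulant p q ε u 0)
        - (Complex.exp (cumulant p q ε u v) + Complex.exp (cumulant p q ε u (-v))) / 2
        - (Real.exp (-((∫ s, p s ^ 2) * u ^ 2 / 2))
            * (1 - Real.exp (-((∫ s, q s ^ 2) * v ^ 2 / 2))) : ℝ)‖
      ≤ ε * (8 * M * (∫ s, p s ^ 2) * C + 4 * M * (∫ s, q s ^ 2)
          * (|v| ^ 3 * Real.exp (-((∫ s, q s ^ 2) * v ^ 2 / 4)))) := by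
  have hv0 : ε * |(0 : ℝ)| * (2 * M) ≤ 1 := by simp
  have hvn : ε * |-v| * (2 * M) ≤ 1 := by rwa [abs_neg]
  have h0 := H.norm_cexp_cumulant_sub_gaussian_le hε hu hv0
  have h1 := H.norm_cexp_cumulant_sub_gaussian_le hε hu hv
  have h2 := H.norm_cexp_cumulant_sub_gaussian_le hε hu hvn
  have hm0 : 0 ≤ ∫ s, p s ^ 2 := integral_nonneg fun s => sq_nonneg _
  have hM := H.pos
  generalize ∫ s, p s ^ 2 = m₀ at *
  generalize ∫ s, q s ^ 2 = m₂ at *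
  have hcu := abs_cube_mul_le' (Real.exp_pos _).le hC.le (hC0 u)
  rw [abs_neg, neg_sq] at h2
  have e0 : -((m₀ * u ^ 2 + m₂ * 0 ^ 2) / 2) = -(m₀ * u ^ 2 / 2) := by ring
  have e1 : Real.exp (-((m₀ * u ^ 2 + m₂ * v ^ 2) / 2))
      = Real.exp (-(m₀ * u ^ 2 / 2)) * Real.exp (-(m₂ * v ^ 2 / 2)) := by
    rw [← Real.exp_add]; ring_nf
  rw [e0] at h0
  rw [e1] at h1 h2
  simp only [abs_zero, ne_eq, OfNat.ofNat_ne_zero, not_false_eq_true, zero_pow, zero_mul,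
        mul_zero, add_zero] at h0
  generalize Real.exp (-(m₀ * u ^ 2 / 2)) = a at *
  generalize Real.exp (-(m₂ * v ^ 2 / 2)) = b at *
  -- The three values of the characteristic function are compared with their Gaussian limits
  -- separately: away from `v = 0` no factor `v²` has to be gained by cancellation.
  have hdec : Complex.exp (cumulant p q ε u 0)
        - (Complex.exp (cumulant p q ε u v) + Complex.exp (cumulant p q ε u (-v))) / 2
        - (a * (1 - b) : ℝ)
      = (Complex.exp (cumulant p q ε u 0) - (a : ℝ))
        - ((Complex.exp (cumulant p q ε u v) - (a * b : ℝ))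
          + (Complex.exp (cumulant p q ε u (-v)) - (a * b : ℝ))) / 2 := by
    push_cast; ring
  have hn2 : ‖(2 : ℂ)‖ = 2 := by simp
  rw [hdec]
  refine (norm_sub_le _ _).trans ?_
  rw [norm_div, hn2]
  have h3 := norm_add_le (Complex.exp (cumulant p q ε u v) - (a * b : ℝ))
    (Complex.exp (cumulant p q ε u (-v)) - (a * b : ℝ))
  have h4 : ε * (4 * M * (m₀ * (|u| ^ 3 * Real.exp (-(m₀ * u ^ 2 / 4))))) ≤ ε * (4 * M * (m₀ * C)) := by
    gcongr
  linarith

theorem norm_second_difference_le_four (H : BoundedKernelPair p q M) (ε u v : ℝ) :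
    ‖Complex.exp (cumulant p q ε u 0)
        - (Complex.exp (cumulant p q ε u v) + Complex.exp (cumulant p q ε u (-v))) / 2
        - (Real.exp (-((∫ s, p s ^ 2) * u ^ 2 / 2))
            * (1 - Real.exp (-((∫ s, q s ^ 2) * v ^ 2 / 2))) : ℝ)‖ ≤ 4 := by
  have hm0 : 0 ≤ ∫ s, p s ^ 2 := integral_nonneg fun s => sq_nonneg _
  have hm2 : 0 ≤ ∫ s, q s ^ 2 := integral_nonneg fun s => sq_nonneg _
  have h0 := H.norm_cexp_cumulant_le_one ε u 0
  have h1 := H.norm_cexp_cumulant_le_one ε u v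
  have h2 := H.norm_cexp_cumulant_le_one ε u (-v)
  have ha : Real.exp (-((∫ s, p s ^ 2) * u ^ 2 / 2)) ≤ 1 := Real.exp_le_one_iff.2 (by
    have := mul_nonneg hm0 (sq_nonneg u); linarith)
  have hb : Real.exp (-((∫ s, q s ^ 2) * v ^ 2 / 2)) ≤ 1 := Real.exp_le_one_iff.2 (by
    have := mul_nonneg hm2 (sq_nonneg v); linarith)
  have ha0 := Real.exp_pos (-((∫ s, p s ^ 2) * u ^ 2 / 2))
  have hb0 := Real.exp_pos (-((∫ s, q s ^ 2) * v ^ 2 / 2))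
  have hn2 : ‖(2 : ℂ)‖ = 2 := by simp
  refine (norm_sub_le _ _).trans ((add_le_add (norm_sub_le _ _) le_rfl).trans ?_)
  rw [norm_div, hn2, Complex.norm_real, Real.norm_of_nonneg (mul_nonneg ha0.le (by linarith))]
  have h3 := norm_add_le (Complex.exp (cumulant p q ε u v)) (Complex.exp (cumulant p q ε u (-v)))
  nlinarith

/-- The second difference of the characteristic function is close to its Gaussian limit. -/
theorem exists_norm_second_difference_div_sq_le (H : BoundedKernelPair p q M)
    (hm0 : 0 < ∫ s, p s ^ 2) (hm2 : 0 < ∫ s, q s ^ 2) :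
    ∃ A, 0 < A ∧ ∀ ε u v : ℝ, 0 < ε → ε ≤ 1 → ε * |u| * (2 * M) ≤ 1 → v ≠ 0 →
      ‖Complex.exp (cumulant p q ε u 0)
        - (Complex.exp (cumulant p q ε u v) + Complex.exp (cumulant p q ε u (-v))) / 2
        - (Real.exp (-((∫ s, p s ^ 2) * u ^ 2 / 2))
            * (1 - Real.exp (-((∫ s, q s ^ 2) * v ^ 2 / 2))) : ℝ)‖ / v ^ 2
      ≤ ε * (A * (1 + |u|)) * (1 + v ^ 2)⁻¹
        + 8 * (2 * M * ε) ^ 2 * (1 + (2 * M * ε * v) ^ 2)⁻¹ := by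
  obtain ⟨C, hC, hC0⟩ := exists_pow_four_mul_exp_neg_le hm0
  obtain ⟨C', hC', hC2⟩ := exists_pow_four_mul_exp_neg_le hm2
  have hM := H.pos
  -- Sum of the constants for the intermediate and the small frequencies. The doublings come from `1
  -- ≤ 2v²/(1 + v²)` for `|v| ≥ 1` and from `1 ≤ 2/(1 + v²)` for `|v| ≤ 1`.
  refine ⟨16 * M * (∫ s, p s ^ 2) * C + 4 * M * (∫ s, q s ^ 2) * C'
    + 2 * (2 * M * (∫ s, p s ^ 2) * C * (∫ s, q s ^ 2) + M * (∫ s, q s ^ 2)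
      + M ^ 2 * ((∫ s, p s ^ 2) + 2 * ∫ s, q s ^ 2) ^ 2 * C), by positivity,
    fun ε u v hε hε1 hu hv0 => ?_⟩
  have hsmall := H.norm_second_difference_le_of_abs_le_one (v := v) hC hC0 hε hε1 hu
  have hmid := H.norm_second_difference_le (v := v) hC hC0 hε hu
  have hbig := H.norm_second_difference_le_four ε u v
  have hCv := abs_cube_mul_le (Real.exp_pos _).le (hC2 v)
  have hv2 : 0 < v ^ 2 := by positivity
  generalize ‖Complex.exp (cumulant p q ε u 0)
        - (Complex.exp (cumulant p q ε u v) + Complex.exp (cumulant p q ε u (-v))) / 2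
        - (Real.exp (-((∫ s, p s ^ 2) * u ^ 2 / 2))
            * (1 - Real.exp (-((∫ s, q s ^ 2) * v ^ 2 / 2))) : ℝ)‖ = N at *
  generalize ∫ s, p s ^ 2 = m₀ at *
  generalize ∫ s, q s ^ 2 = m₂ at *
  have hu0 := abs_nonneg u
  set B₁ := 16 * M * m₀ * C + 4 * M * m₂ * C' with hB₁
  set B₂ := 2 * M * m₀ * C * m₂ + M * m₂ + M ^ 2 * (m₀ + 2 * m₂) ^ 2 * C with hB₂
  have hB₁0 : 0 ≤ B₁ := by positivity
  have hB₂0 : 0 ≤ B₂ := by positivity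
  have hw : 0 < (1 + v ^ 2)⁻¹ := by positivity
  have hfirst : 0 ≤ ε * ((B₁ + 2 * B₂) * (1 + |u|)) * (1 + v ^ 2)⁻¹ := by positivity
  have hsecond : 0 ≤ 8 * (2 * M * ε) ^ 2 * (1 + (2 * M * ε * v) ^ 2)⁻¹ := by positivity
  by_cases hv : ε * |v| * (2 * M) ≤ 1
  · refine le_add_of_le_of_nonneg ?_ hsecond
    by_cases hv1 : |v| ≤ 1
    · have h1 := hsmall hv hv1
      have hvsq : v ^ 2 ≤ 1 := by rw [← sq_abs]; exact pow_le_one₀ (abs_nonneg v) hv1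
      have h2 : 1 ≤ 2 * (1 + v ^ 2)⁻¹ := by
        rw [← div_eq_mul_inv, le_div_iff₀ (by positivity)]; linarith
      rw [div_le_iff₀ hv2]
      refine h1.trans ?_
      have h3 : 2 * M * m₀ * C * m₂ + M * m₂ * (1 + |u|) + M ^ 2 * (m₀ + 2 * m₂) ^ 2 * C
          ≤ B₂ * (1 + |u|) := by
        have : 0 ≤ (2 * M * m₀ * C * m₂ + M ^ 2 * (m₀ + 2 * m₂) ^ 2 * C) * |u| := by positivity
        rw [hB₂]; linarith
      calc ε * v ^ 2 * (2 * M * m₀ * C * m₂ + M * m₂ * (1 + |u|)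
            + M ^ 2 * (m₀ + 2 * m₂) ^ 2 * C) ≤ ε * v ^ 2 * (B₂ * (1 + |u|)) := by gcongr
        _ ≤ ε * v ^ 2 * (B₂ * (1 + |u|)) * (2 * (1 + v ^ 2)⁻¹) :=
            le_mul_of_one_le_right (by positivity) h2
        _ = ε * ((0 + 2 * B₂) * (1 + |u|)) * (1 + v ^ 2)⁻¹ * v ^ 2 := by ring
        _ ≤ ε * ((B₁ + 2 * B₂) * (1 + |u|)) * (1 + v ^ 2)⁻¹ * v ^ 2 := by gcongr
    · have h1 := hmid hv
      have hvsq : 1 ≤ v ^ 2 := by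
        rw [← sq_abs]; exact one_le_pow₀ (not_le.1 hv1).le
      have h2 : 1 ≤ 2 * (1 + v ^ 2)⁻¹ * v ^ 2 := by
        rw [← div_eq_mul_inv, div_mul_eq_mul_div, le_div_iff₀ (by positivity)]; linarith
      rw [div_le_iff₀ hv2]
      refine h1.trans ?_
      calc ε * (8 * M * m₀ * C + 4 * M * m₂ * (|v| ^ 3 * Real.exp (-(m₂ * v ^ 2 / 4))))
          ≤ ε * (8 * M * m₀ * C * (2 * (1 + v ^ 2)⁻¹ * v ^ 2)
              + 4 * M * m₂ * (C' * (1 + v ^ 2)⁻¹ * v ^ 2)) := by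
            refine mul_le_mul_of_nonneg_left (add_le_add ?_ ?_) hε.le
            · exact le_mul_of_one_le_right (by positivity) h2
            · exact mul_le_mul_of_nonneg_left
                (hCv.trans (le_mul_of_one_le_right (by positivity) hvsq)) (by positivity)
        _ = ε * ((B₁ + 2 * 0) * (1 + 0)) * (1 + v ^ 2)⁻¹ * v ^ 2 := by rw [hB₁]; ring
        _ ≤ ε * ((B₁ + 2 * B₂) * (1 + |u|)) * (1 + v ^ 2)⁻¹ * v ^ 2 := by gcongr
  -- For large `v` put `k = 2Mε`. As `(kv)² ≥ 1`, the trivial bound `4/v²` is at most `8k²/(1 +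
  -- (kv)²)`, whose integral over the line is `8kπ`, of order `ε`.
  · refine le_add_of_nonneg_of_le hfirst ?_
    have h1 : 1 ≤ (2 * M * ε * v) ^ 2 := by
      rw [← sq_abs, abs_mul, abs_of_pos (by positivity : 0 < 2 * M * ε)]
      refine one_le_pow₀ ?_
      linarith [not_le.1 hv]
    rw [div_le_iff₀ hv2]
    refine hbig.trans ?_
    rw [mul_assoc, ← div_eq_inv_mul, ← mul_div_assoc, le_div_iff₀ (by positivity)]
    nlinarith

end BoundedKernelPair

end FourierEstimate

/-! ### The fixed-time estimate for the shot noise -/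

section ShotNoiseEstimate

open Filter Set
open scoped ENNReal NNReal Topology

namespace KernelAssumption

variable {g : ℝ → ℝ}

theorem integral_deriv_eq_zero (hg : KernelAssumption g) : ∫ s, deriv g s = 0 :=
  integral_eq_zero_of_hasDerivAt_of_integrable hg.hasDerivAt hg.integrable_deriv hg.integrable

/-- The Sobolev inequality bounds `g` and `g'`, the latter by means of `g''`. Orthogonality holds
because `2 g g'` is the derivative of the integrable function `g²`. -/
theorem exists_boundedKernelPair (hg : KernelAssumption g) :
    ∃ M, BoundedKernelPair g (deriv g) M := by
  have hc1 := hg.contDiff_deriv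
  obtain ⟨M₁, hM₁, hb₁⟩ := exists_norm_le_of_integrable_deriv hg.hasDerivAt hc1.continuous
    hg.integrable hg.integrable_deriv
  obtain ⟨M₂, hM₂, hb₂⟩ := exists_norm_le_of_integrable_deriv hg.hasDerivAt_deriv (hc1.continuous_deriv le_rfl)
    hg.integrable_deriv hg.integrable_deriv_deriv
  have hgc : Continuous g := hg.contDiff.continuous
  refine ⟨M₁ + M₂ + 1, hgc, hc1.continuous, hg.integrable, hg.integrable_deriv, by positivity,
    fun s => (hb₁ s).trans (by linarith), fun s => (hb₂ s).trans (by linarith), ?_⟩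
  have i1 : Integrable fun s => g s * g s :=
    BoundedKernelPair.integrable_mul_of_bounded hg.integrable hgc hb₁
  have i2 : Integrable fun s => g s * deriv g s :=
    BoundedKernelPair.integrable_mul_of_bounded hg.integrable hc1.continuous hb₂
  have hder : ∀ s, HasDerivAt (fun s => g s * g s) (2 * (g s * deriv g s)) s := fun s => by
    convert! (hg.hasDerivAt s).mul (hg.hasDerivAt s) using 1
    ring
  have h0 := integral_eq_zero_of_hasDerivAt_of_integrable hder (i2.const_mul 2) i1
  rw [integral_const_mul] at h0
  linarith

theorem deriv_eq_zero_of_integral_sq_deriv (hg : KernelAssumption g)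
    (h : ∫ s, deriv g s ^ 2 = 0) (s : ℝ) : deriv g s = 0 := by
  obtain ⟨M, H⟩ := hg.exists_boundedKernelPair
  have hc := H.continuous_snd
  have h1 := (integral_eq_zero_iff_of_nonneg (fun s => sq_nonneg (deriv g s))
    H.integrable_sq_snd).1 h
  have h2 := Continuous.ae_eq_iff_eq volume (hc.pow 2) continuous_const |>.1 h1
  exact pow_eq_zero_iff (two_ne_zero) |>.1 (congrFun h2 s)

theorem integral_sq_pos (hg : KernelAssumption g) (h : 0 < ∫ s, deriv g s ^ 2) :
    0 < ∫ s, g s ^ 2 := by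
  obtain ⟨M, H⟩ := hg.exists_boundedKernelPair
  refine lt_of_le_of_ne (integral_nonneg fun s => sq_nonneg _) fun h0 => ?_
  have h1 := (integral_eq_zero_iff_of_nonneg (fun s => sq_nonneg (g s))
    H.integrable_sq_fst).1 h0.symm
  have h2 := Continuous.ae_eq_iff_eq volume (H.continuous_fst.pow 2) continuous_const |>.1 h1
  have h3 : g = fun _ => 0 := funext fun s => pow_eq_zero_iff (two_ne_zero) |>.1 (congrFun h2 s)
  rw [h3] at h
  simp at h

end KernelAssumption

variable {Ω : Type*} [MeasurableSpace Ω] {P : Measure Ω} [IsProbabilityMeasure P]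
  {τ : ℕ → Ω → ℝ} {lam : ℝ} {g : ℝ → ℝ}

theorem integrable_sub_left_smul_volume {f : ℝ → ℝ} (hf : Integrable f) (lam t : ℝ) :
    Integrable (fun s => f (t - s)) (ENNReal.ofReal lam • volume) :=
  (hf.comp_sub_left t).smul_measure ENNReal.ofReal_ne_top

theorem integral_sub_left_smul_volume {E : Type*} [NormedAddCommGroup E] [NormedSpace ℝ E]
    (f : ℝ → E) (hlam : 0 < lam) (t : ℝ) :
    ∫ s, f (t - s) ∂(ENNReal.ofReal lam • volume) = lam • ∫ s, f s := by
  rw [integral_smul_measure, ENNReal.toReal_ofReal hlam.le, integral_sub_left_eq_self f volume t]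

theorem integral_abs_tsum_comp_le (hτ : IsPoissonPointProcess τ (ENNReal.ofReal lam • volume) P)
    (hlam : 0 < lam) {f : ℝ → ℝ} (hfc : Measurable f) (hf : Integrable f) (t : ℝ) :
    ∫ ω, |∑' i, f (t - τ i ω)| ∂P ≤ lam * ∫ s, |f s| := by
  have hm : Measurable fun s => f (t - s) := hfc.comp (measurable_const.sub measurable_id)
  have hi := integrable_sub_left_smul_volume hf lam t
  have h1 := hτ.lintegral_enorm_tsum_comp_le hm
  have h2 := ENNReal.toReal_mono hi.2.ne h1
  rw [← integral_norm_eq_lintegral_enorm hi.1,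
    ← integral_norm_eq_lintegral_enorm (hτ.integrable_tsum_comp hm hi).1,
    integral_sub_left_smul_volume (fun s => ‖f s‖) hlam t] at h2
  exact h2

/-- The joint characteristic function of the normalized shot noise and its derivative. -/
theorem integral_cexp_shotNoise (hg : KernelAssumption g)
    (hτ : IsPoissonPointProcess τ (ENNReal.ofReal lam • volume) P) (hlam : 0 < lam) (t u v : ℝ) :
    ∫ ω, Complex.exp (Complex.I * (u * ((∑' i, g (t - τ i ω) - lam * ∫ s, g s) / √lam)
        + v * ((∑' i, deriv g (t - τ i ω)) / √lam) : ℝ)) ∂P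
      = Complex.exp (cumulant g (deriv g) (√lam)⁻¹ u v) := by
  obtain ⟨M, H⟩ := hg.exists_boundedKernelPair
  have hgm := H.continuous_fst.measurable
  have hdm := H.continuous_snd.measurable
  set ε := (√lam)⁻¹ with hε
  have hsq : 0 < √lam := Real.sqrt_pos.2 hlam
  have hεlam : lam * ε = √lam := by
    rw [hε]; nth_rewrite 1 [← Real.mul_self_sqrt hlam.le]; field_simp
  have hε2 : (ε ^ 2)⁻¹ = lam := by
    rw [hε, inv_pow, inv_inv, Real.sq_sqrt hlam.le]
  let z : ℝ → ℝ := fun s => ε * (u * g s + v * deriv g s)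
  have hz : Integrable z := H.integrable_linear ε u v
  have hzm : Measurable z := by fun_prop
  have hms : ∀ {f : ℝ → ℝ}, Measurable f → Measurable fun s => f (t - s) := fun hf =>
    hf.comp (measurable_const.sub measurable_id)
  -- The combination of the two sums is a single Poisson sum, that of `z`, up to the deterministic
  -- phase produced by centring.
  have hae : ∀ᵐ ω ∂P, Complex.exp (Complex.I * (u * ((∑' i, g (t - τ i ω) - lam * ∫ s, g s) / √lam)
        + v * ((∑' i, deriv g (t - τ i ω)) / √lam) : ℝ))
      = Complex.exp (Complex.I * (-(u * √lam * ∫ s, g s) : ℝ))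
        * Complex.exp (Complex.I * (∑' i, z (t - τ i ω) : ℝ)) := by
    filter_upwards [hτ.ae_summable_norm_comp (hms hgm)
        (integrable_sub_left_smul_volume hg.integrable lam t),
      hτ.ae_summable_norm_comp (hms hdm)
        (integrable_sub_left_smul_volume hg.integrable_deriv lam t)] with ω h1 h2
    have h3 : ∑' i, z (t - τ i ω)
        = ε * (u * ∑' i, g (t - τ i ω) + v * ∑' i, deriv g (t - τ i ω)) := by
      rw [← tsum_mul_left, ← tsum_mul_left,
        ← (h1.of_norm.mul_left u).tsum_add (h2.of_norm.mul_left v), ← tsum_mul_left]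
    rw [← Complex.exp_add, ← mul_add, ← Complex.ofReal_add, h3]
    congr 3
    rw [div_eq_mul_inv, div_eq_mul_inv, ← hε]
    linear_combination (-(u * ∫ s, g s)) * hεlam
  rw [integral_congr_ae hae, integral_const_mul,
    hτ.integral_cexp_tsum (hms hzm) (integrable_sub_left_smul_volume hz lam t),
    integral_sub_left_smul_volume (fun s => Complex.exp (Complex.I * z s) - 1) hlam t,
    ← Complex.exp_add]
  congr 1
  have hi1 : Integrable fun s => Complex.exp (Complex.I * (z s : ℝ)) - 1 := by
    refine hz.mono (by fun_prop) (Eventually.of_forall fun s => ?_)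
    exact Real.norm_exp_I_mul_ofReal_sub_one_le
  have hi2 : Integrable fun s => Complex.I * ((z s : ℝ) : ℂ) := hz.ofReal.const_mul _
  have hcum : cumulant g (deriv g) ε u v = (lam : ℂ)
      * ∫ s, ((Complex.exp (Complex.I * (z s : ℝ)) - 1) - Complex.I * (z s : ℝ)) := by
    rw [cumulant, hε2]
  -- Since `∫ g' = 0`, the phase equals `-i lam ∫ z`, which is the linear compensator in `cumulant`.
  have hzint : ∫ s, z s = ε * (u * ∫ s, g s) := by
    simp only [z]
    rw [integral_const_mul, integral_add (hg.integrable.const_mul u)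
      (hg.integrable_deriv.const_mul v), integral_const_mul, integral_const_mul,
      hg.integral_deriv_eq_zero, mul_zero, add_zero]
  rw [hcum, integral_sub hi1 hi2, integral_const_mul, integral_complex_ofReal, hzint,
    Complex.real_smul]
  have hεlam' : (lam : ℂ) * (ε : ℂ) = (√lam : ℂ) := by exact_mod_cast hεlam
  push_cast
  linear_combination (Complex.I * u * ((∫ s, g s : ℝ) : ℂ)) * hεlam'

/-- The characteristic functions of the normalized shot noise paired with `1 - cos (v Z')`. -/
theorem integral_cexp_mul_one_sub_cos_div_sq (hg : KernelAssumption g)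
    (hτ : IsPoissonPointProcess τ (ENNReal.ofReal lam • volume) P) (hlam : 0 < lam) {t : ℝ}
    {Y W : Ω → ℝ} (hYm : Measurable Y) (hWm : Measurable W)
    (hY : ∀ᵐ ω ∂P, Y ω = (∑' i, g (t - τ i ω) - lam * ∫ s, g s) / √lam)
    (hW : ∀ᵐ ω ∂P, W ω = (∑' i, deriv g (t - τ i ω)) / √lam) (u v : ℝ) :
    ∫ ω, Complex.exp (Complex.I * u * Y ω) * ((1 - Real.cos (v * W ω)) / v ^ 2 : ℝ) ∂P
      = (Complex.exp (cumulant g (deriv g) (√lam)⁻¹ u 0)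
        - (Complex.exp (cumulant g (deriv g) (√lam)⁻¹ u v)
          + Complex.exp (cumulant g (deriv g) (√lam)⁻¹ u (-v))) / 2) / (v ^ 2 : ℝ) := by
  have hch : ∀ w : ℝ, ∫ ω, Complex.exp (Complex.I * (u * Y ω + w * W ω : ℝ)) ∂P
      = Complex.exp (cumulant g (deriv g) (√lam)⁻¹ u w) := by
    intro w
    rw [← integral_cexp_shotNoise hg hτ hlam t u w]
    refine integral_congr_ae ?_
    filter_upwards [hY, hW] with ω h1 h2
    rw [h1, h2]
  have hi : ∀ w : ℝ, Integrable (fun ω => Complex.exp (Complex.I * (u * Y ω + w * W ω : ℝ))) P := by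
    intro w
    refine Integrable.mono' (integrable_const (1 : ℝ))
      (Measurable.aestronglyMeasurable (by fun_prop)) (Eventually.of_forall fun ω => ?_)
    rw [BoundedKernelPair.norm_cexp_I_mul_ofReal]
  have hpt : ∀ ω, Complex.exp (Complex.I * u * Y ω) * ((1 - Real.cos (v * W ω)) / v ^ 2 : ℝ)
      = (Complex.exp (Complex.I * (u * Y ω + 0 * W ω : ℝ))
        - (Complex.exp (Complex.I * (u * Y ω + v * W ω : ℝ))
          + Complex.exp (Complex.I * (u * Y ω + -v * W ω : ℝ))) / 2) / (v ^ 2 : ℝ) := by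
    intro ω
    have e0 : Complex.exp (Complex.I * (u * Y ω + 0 * W ω : ℝ))
        = Complex.exp (Complex.I * u * Y ω) := by push_cast; ring_nf
    have e1 : Complex.exp (Complex.I * (u * Y ω + v * W ω : ℝ))
        = Complex.exp (Complex.I * u * Y ω) * Complex.exp ((v * W ω : ℝ) * Complex.I) := by
      rw [← Complex.exp_add]; push_cast; ring_nf
    have e2 : Complex.exp (Complex.I * (u * Y ω + -v * W ω : ℝ))
        = Complex.exp (Complex.I * u * Y ω) * Complex.exp (-(v * W ω : ℝ) * Complex.I) := by
      rw [← Complex.exp_add]; push_cast; ring_nf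
    rw [e0, e1, e2]
    push_cast
    rw [Complex.cos]
    ring
  simp_rw [hpt]
  have hi2 : Integrable (fun ω => (Complex.exp (Complex.I * (u * Y ω + v * W ω : ℝ))
      + Complex.exp (Complex.I * (u * Y ω + -v * W ω : ℝ))) / 2) P :=
    ((hi v).add (hi (-v))).div_const 2
  rw [integral_div, integral_sub (hi 0) hi2, integral_div, integral_add (hi v) (hi (-v)), hch, hch,
    hch]

theorem integral_inv_one_add_mul_sq {k : ℝ} (hk : 0 < k) :
    Integrable (fun v : ℝ => (1 + (k * v) ^ 2)⁻¹) ∧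
      ∫ v : ℝ, (1 + (k * v) ^ 2)⁻¹ = k⁻¹ * Real.pi := by
  refine ⟨integrable_inv_one_add_sq.comp_mul_left' hk.ne', ?_⟩
  rw [Measure.integral_comp_mul_left (fun x : ℝ => (1 + x ^ 2)⁻¹) k, integral_univ_inv_one_add_sq,
    smul_eq_mul, abs_of_pos (inv_pos.2 hk)]

theorem norm_integral_cexp_mul_abs_le {Ω : Type*} [MeasurableSpace Ω] {P : Measure Ω} {Y W : Ω → ℝ} (u : ℝ) :
    ‖∫ ω, Complex.exp (Complex.I * u * Y ω) * (|W ω| : ℝ) ∂P‖ ≤ ∫ ω, |W ω| ∂P := by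
  refine (norm_integral_le_integral_norm _).trans_eq ?_
  congr 1
  funext ω
  rw [norm_mul, mul_assoc, ← Complex.ofReal_mul, BoundedKernelPair.norm_cexp_I_mul_ofReal, one_mul,
    Complex.norm_real, Real.norm_eq_abs, abs_abs]

/-- Gaussian approximation at a fixed time of the integrand in the Rice formula. -/
theorem exists_norm_integral_cexp_mul_abs_sub_le.{w} (hg : KernelAssumption g) :
    ∃ a₁ a₂ a₃ : ℝ, 0 < a₁ ∧ 0 < a₂ ∧ 0 < a₃ ∧
      ∀ (Ω : Type w) [MeasurableSpace Ω] (P : Measure Ω) [IsProbabilityMeasure P]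
        (lam : ℝ) (_ : 0 < lam) (τ : ℕ → Ω → ℝ)
        (_ : IsPoissonPointProcess τ (ENNReal.ofReal lam • volume) P) (t : ℝ) (Y W : Ω → ℝ)
        (_ : Measurable Y) (_ : Measurable W)
        (_ : ∀ᵐ ω ∂P, Y ω = (∑' i, g (t - τ i ω) - lam * ∫ s, g s) / √lam)
        (_ : ∀ᵐ ω ∂P, W ω = (∑' i, deriv g (t - τ i ω)) / √lam)
        (u : ℝ), |u| < a₁ * √lam →
          ‖∫ ω, Complex.exp (Complex.I * u * Y ω) * (|W ω| : ℝ) ∂P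
              - ((√(2 * (∫ s, deriv g s ^ 2) / Real.pi)
                  * Real.exp (-(∫ s, g s ^ 2) * u ^ 2 / 2) : ℝ) : ℂ)‖
            ≤ (a₂ + a₃ * |u|) / √lam := by
  -- If `∫ g'² = 0` then `g' = 0` by continuity and both compared quantities vanish. Otherwise both
  -- variances are positive, as Gaussian decay requires.
  rcases (integral_nonneg fun s => sq_nonneg (deriv g s) : 0 ≤ ∫ s, deriv g s ^ 2).eq_or_lt
    with hm2 | hm2
  · refine ⟨1, 1, 1, one_pos, one_pos, one_pos, ?_⟩
    intro Ω _ P _ lam hlam τ hτ t Y W hYm hWm hY hW u hu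
    have h0 : ∫ ω, Complex.exp (Complex.I * u * Y ω) * (|W ω| : ℝ) ∂P = 0 := by
      refine integral_eq_zero_of_ae ?_
      filter_upwards [hW] with ω h
      simp [h, hg.deriv_eq_zero_of_integral_sq_deriv hm2.symm]
    rw [h0, ← hm2]
    simp only [mul_zero, zero_div, Real.sqrt_zero, zero_mul, Complex.ofReal_zero, sub_zero,
      norm_zero]
    positivity
  have hm0 := hg.integral_sq_pos hm2
  obtain ⟨M, H⟩ := hg.exists_boundedKernelPair
  have hM := H.pos
  obtain ⟨A, hA, hest⟩ := H.exists_norm_second_difference_div_sq_le hm0 hm2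
  obtain ⟨hGi, hGe⟩ := integral_fejerKernel_mul_sqrt hm2
  set c := ∫ v, fejerKernel v with hc
  have hcpos : 0 < c := integral_fejerKernel_pos
  have hpi := Real.pi_pos
  have hg1 : 0 ≤ ∫ s, |deriv g s| := integral_nonneg fun s => abs_nonneg _
  set T := √(2 * (∫ s, deriv g s ^ 2) / Real.pi) with hT
  have hT0 : 0 ≤ T := Real.sqrt_nonneg _
  -- The value of `a₁` turns `|u| < a₁√lam` into `ε|u|·2M ≤ 1`. The factors with `c⁻¹` are the
  -- `v`-integrals of the two weights in the second-difference bound, `πA(1 + |u|)` and `16πM`; the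
  -- last summand of `a₂` covers `lam < 1`.
  refine ⟨1 / (2 * M), c⁻¹ * (Real.pi * (A + 16 * M)) + ((∫ s, |deriv g s|) + T),
    c⁻¹ * (Real.pi * A), by positivity, by positivity, by positivity, ?_⟩
  intro Ω _ P _ lam hlam τ hτ t Y W hYm hWm hY hW u hu
  have hsq : 0 < √lam := Real.sqrt_pos.2 hlam
  have hdm := H.continuous_snd.measurable
  have hms : Measurable fun s => deriv g (t - s) :=
    hdm.comp (measurable_const.sub measurable_id)
  have hSi := hτ.integrable_tsum_comp hms
    (integrable_sub_left_smul_volume hg.integrable_deriv lam t)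
  have hWi : Integrable W P := (hSi.div_const (√lam)).congr (hW.mono fun ω h => h.symm)
  have hexp1 : Real.exp (-(∫ s, g s ^ 2) * u ^ 2 / 2) ≤ 1 := Real.exp_le_one_iff.2 (by
    have := mul_nonneg hm0.le (sq_nonneg u); linarith)
  -- For `lam < 1` no approximation is needed: `E|W| ≤ √lam ∫|g'|` is bounded, and division of the
  -- right-hand side by `√lam` only enlarges it.
  rcases lt_or_ge lam 1 with hlam1 | hlam1
  · have hsq1 : √lam ≤ 1 := Real.sqrt_le_one.2 hlam1.le
    have h1 : ∫ ω, |W ω| ∂P ≤ ∫ s, |deriv g s| := by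
      have h2 : ∫ ω, |W ω| ∂P = (∫ ω, |∑' i, deriv g (t - τ i ω)| ∂P) / √lam := by
        rw [← integral_div]
        refine integral_congr_ae (hW.mono fun ω h => ?_)
        simp only
        rw [h, abs_div, abs_of_pos hsq]
      rw [h2, div_le_iff₀ hsq]
      refine (integral_abs_tsum_comp_le hτ hlam hdm hg.integrable_deriv t).trans ?_
      rw [mul_comm]
      refine mul_le_mul_of_nonneg_left ?_ hg1
      nth_rewrite 1 [← Real.mul_self_sqrt hlam.le]
      exact mul_le_of_le_one_left hsq.le hsq1
    have h3 := (norm_integral_cexp_mul_abs_le (P := P) (Y := Y) (W := W) u).trans h1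
    refine (norm_sub_le _ _).trans ?_
    rw [Complex.norm_real, Real.norm_of_nonneg (by positivity)]
    have h4 : T * Real.exp (-(∫ s, g s ^ 2) * u ^ 2 / 2) ≤ T :=
      mul_le_of_le_one_right hT0 hexp1
    have h5 : 0 ≤ c⁻¹ * (Real.pi * (A + 16 * M)) + c⁻¹ * (Real.pi * A) * |u| := by positivity
    rw [le_div_iff₀ hsq]
    calc _ ≤ ((∫ s, |deriv g s|) + T) * 1 := by
          refine mul_le_mul (add_le_add h3 h4) hsq1 hsq.le (by positivity)
      _ ≤ _ := by linarith
  · set ε := (√lam)⁻¹ with hε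
    have hε0 : 0 < ε := inv_pos.2 hsq
    have hε1 : ε ≤ 1 := inv_le_one_of_one_le₀ (Real.one_le_sqrt.2 hlam1)
    have hu' : ε * |u| * (2 * M) ≤ 1 := by
      rw [hε, mul_assoc, inv_mul_le_iff₀ hsq, mul_one]
      have := mul_le_mul_of_nonneg_right hu.le (by positivity : 0 ≤ 2 * M)
      refine this.trans_eq ?_
      field_simp
    have hem : Measurable fun ω => Complex.exp (Complex.I * u * Y ω) := by fun_prop
    obtain ⟨hi, he⟩ := integral_fejerKernel_mul_integral_mul_abs (P := P) hem
      (fun ω => by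
        rw [mul_assoc, ← Complex.ofReal_mul, BoundedKernelPair.norm_cexp_I_mul_ofReal]) hWm hWi
    simp_rw [integral_cexp_mul_one_sub_cos_div_sq hg hτ hlam hYm hWm hY hW u] at hi he
    rw [← hc, ← hε] at he
    rw [← hε] at hi
    set G := Real.exp (-(∫ s, g s ^ 2) * u ^ 2 / 2) with hG
    have hGi' : Integrable fun v : ℝ =>
        ((G * ((1 - Real.exp (-((∫ s, deriv g s ^ 2) * v ^ 2 / 2))) / v ^ 2) : ℝ) : ℂ) :=
      (hGi.const_mul G).ofReal
    -- The difference of the two absolute moments, both expressed through the same kernel, is a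
    -- single integral over `v` to which the pointwise estimate applies off the null set `v = 0`.
    have hdiff : (c : ℂ) * (∫ ω, Complex.exp (Complex.I * u * Y ω) * (|W ω| : ℝ) ∂P
          - ((T * G : ℝ) : ℂ))
        = ∫ v : ℝ, ((Complex.exp (cumulant g (deriv g) ε u 0)
          - (Complex.exp (cumulant g (deriv g) ε u v)
            + Complex.exp (cumulant g (deriv g) ε u (-v))) / 2) / (v ^ 2 : ℝ)
          - ((G * ((1 - Real.exp (-((∫ s, deriv g s ^ 2) * v ^ 2 / 2))) / v ^ 2) : ℝ) : ℂ)) := by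
      rw [integral_sub hi hGi', ← he, integral_complex_ofReal, integral_const_mul, ← hGe]
      push_cast
      ring
    obtain ⟨hki, hke⟩ := integral_inv_one_add_mul_sq (k := 2 * M * ε) (by positivity)
    have hHi : Integrable fun v : ℝ => ε * (A * (1 + |u|)) * (1 + v ^ 2)⁻¹
        + 8 * (2 * M * ε) ^ 2 * (1 + (2 * M * ε * v) ^ 2)⁻¹ :=
      (integrable_inv_one_add_sq.const_mul _).add (hki.const_mul _)
    have hGform : G = Real.exp (-((∫ s, g s ^ 2) * u ^ 2 / 2)) := by
      rw [hG]; congr 1; ring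
    have hbound := norm_integral_le_of_norm_le hHi (f := fun v : ℝ =>
        (Complex.exp (cumulant g (deriv g) ε u 0)
          - (Complex.exp (cumulant g (deriv g) ε u v)
            + Complex.exp (cumulant g (deriv g) ε u (-v))) / 2) / (v ^ 2 : ℝ)
          - ((G * ((1 - Real.exp (-((∫ s, deriv g s ^ 2) * v ^ 2 / 2))) / v ^ 2) : ℝ) : ℂ)) (by
      filter_upwards [Measure.ae_ne volume (0 : ℝ)] with v hv
      refine le_trans (le_of_eq ?_) (hest ε u v hε0 hε1 hu' hv)
      rw [← mul_div_assoc, Complex.ofReal_div, ← sub_div, norm_div, Complex.norm_real,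
        Real.norm_of_nonneg (sq_nonneg v), hGform])
    rw [← hdiff, norm_mul, Complex.norm_real, Real.norm_of_nonneg hcpos.le,
      integral_add (integrable_inv_one_add_sq.const_mul _) (hki.const_mul _), integral_const_mul,
      integral_const_mul, integral_univ_inv_one_add_sq, hke] at hbound
    have h6 : 8 * (2 * M * ε) ^ 2 * ((2 * M * ε)⁻¹ * Real.pi) = ε * (Real.pi * (16 * M)) := by
      have : 2 * M * ε ≠ 0 := by positivity
      field_simp
      ring
    rw [h6] at hbound
    rw [div_eq_mul_inv, ← hε]
    have h7 := mul_le_mul_of_nonneg_left hbound (inv_pos.2 hcpos).le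
    rw [inv_mul_cancel_left₀ hcpos.ne'] at h7
    have h8 : 0 ≤ ((∫ s, |deriv g s|) + T) * ε := by positivity
    refine h7.trans ?_
    linarith

end ShotNoiseEstimate

/-! ### From the normalized process to its smooth version, and the conclusion -/

section NormalizedProcess

open Filter Set

variable {Ω : Type*} [MeasurableSpace Ω] {P : Measure Ω}

theorem meanCrossings_congr_ae {Z Y : ℝ → Ω → ℝ} (h : ∀ᵐ ω ∂P, ∀ t, Z t ω = Y t ω) (a b : ℝ) :
    meanCrossings P Z a b = meanCrossings P Y a b := by
  funext α
  refine lintegral_congr_ae (h.mono fun ω hω => ?_)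
  simp only [hω]

theorem integrable_prod_of_integral_abs_le [IsProbabilityMeasure P] {W : ℝ → Ω → ℝ}
    (hWm : ∀ t, Measurable (W t)) (hWc : ∀ ω, Continuous fun t => W t ω)
    (hWi : ∀ t, Integrable (W t) P) {C : ℝ} (hC : ∀ t, ∫ ω, |W t ω| ∂P ≤ C) (a b : ℝ) :
    Integrable (fun p : ℝ × Ω => W p.1 p.2) ((volume.restrict (Icc a b)).prod P) := by
  have hj : Measurable fun p : ℝ × Ω => W p.1 p.2 :=
    measurable_uncurry_of_continuous_of_measurable hWc hWm
  rw [integrable_prod_iff hj.aestronglyMeasurable]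
  refine ⟨Eventually.of_forall hWi, ?_⟩
  refine (integrable_const C).mono' hj.norm.aestronglyMeasurable.integral_prod_right'
    (Eventually.of_forall fun t => ?_)
  rw [Real.norm_of_nonneg (integral_nonneg fun ω => norm_nonneg _)]
  exact hC t

theorem ae_normalizedProcess_shotNoise_eq [IsProbabilityMeasure P] {g : ℝ → ℝ}
    (hg : KernelAssumption g) {lam : ℝ} (hlam : 0 < lam) {τ β : ℕ → Ω → ℝ}
    (hτ : IsPoissonPointProcess τ (ENNReal.ofReal lam • volume) P)
    (hβ : ∀ i, ∀ᵐ ω ∂P, β i ω = 1) :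
    ∀ᵐ ω ∂P, ∀ t, normalizedProcess P lam (shotNoise g β τ) t ω
      = (∑' i, g (t - τ i ω) - lam * ∫ s, g s) / √lam := by
  have hshot : ∀ᵐ ω ∂P, ∀ t, shotNoise g β τ t ω = ∑' i, g (t - τ i ω) := by
    filter_upwards [ae_all_iff.2 hβ] with ω hω t
    simp only [shotNoise, hω, one_mul]
  have hmean : ∀ t, ∫ ω, shotNoise g β τ t ω ∂P = lam * ∫ s, g s := by
    intro t
    have hm : Measurable fun s => g (t - s) :=
      hg.contDiff.continuous.measurable.comp (measurable_const.sub measurable_id)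
    rw [integral_congr_ae (hshot.mono fun ω hω => hω t),
      hτ.integral_tsum_comp hm (integrable_sub_left_smul_volume hg.integrable lam t),
      integral_sub_left_smul_volume g hlam t, smul_eq_mul]
  filter_upwards [hshot] with ω hω t
  rw [normalizedProcess, hmean, hω]

end NormalizedProcess

theorem proposition8 (g : ℝ → ℝ) (hg : KernelAssumption g) :
    ∃ a₁ a₂ a₃ : ℝ, 0 < a₁ ∧ 0 < a₂ ∧ 0 < a₃ ∧
      ∀ (Ω : Type*) [MeasurableSpace Ω] (P : Measure Ω) [IsProbabilityMeasure P]
        (lam : ℝ) (_ : 0 < lam) (τ β : ℕ → Ω → ℝ)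
        (_ : IsPoissonPointProcess τ (ENNReal.ofReal lam • volume) P)
        (_ : ∀ i, ∀ᵐ ω ∂P, β i ω = 1)
        (Z : ℝ → Ω → ℝ) (_ : Z = normalizedProcess P lam (shotNoise g β τ)),
        (∀ᵐ α : ℝ, meanCrossings P Z 0 1 α ≠ ⊤) ∧
        Integrable (fun α => (meanCrossings P Z 0 1 α).toReal) ∧
        ∀ u : ℝ, |u| < a₁ * √lam →
          ‖fourierPlus (fun α => (meanCrossings P Z 0 1 α).toReal) u
              - ((√(2 * (∫ s, deriv g s ^ 2) / Real.pi)
                  * Real.exp (-(∫ s, g s ^ 2) * u ^ 2 / 2) : ℝ) : ℂ)‖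
            ≤ (a₂ + a₃ * |u|) / √lam := by
  obtain ⟨a₁, a₂, a₃, h₁, h₂, h₃, hest⟩ := exists_norm_integral_cexp_mul_abs_sub_le hg
  refine ⟨a₁, a₂, a₃, h₁, h₂, h₃, ?_⟩
  intro Ω _ P _ lam hlam τ β hτ hβ Z hZ
  obtain ⟨X, X', hXm, hX'm, hX, hX'c, hXae⟩ := hτ.exists_smooth_version hg
  have hsq : 0 < √lam := Real.sqrt_pos.2 hlam
  let Y : ℝ → Ω → ℝ := fun t ω => (X t ω - lam * ∫ s, g s) / √lam
  let W : ℝ → Ω → ℝ := fun t ω => X' t ω / √lam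
  have hYm : ∀ t, Measurable (Y t) := fun t => ((hXm t).sub_const _).div_const _
  have hWm : ∀ t, Measurable (W t) := fun t => (hX'm t).div_const _
  have hY : ∀ ω t, HasDerivAt (fun t => Y t ω) (W t ω) t := fun ω t =>
    ((hX ω t).sub_const _).div_const _
  have hWc : ∀ ω, Continuous fun t => W t ω := fun ω => (hX'c ω).div_const _
  have hYae : ∀ t, ∀ᵐ ω ∂P, Y t ω = (∑' i, g (t - τ i ω) - lam * ∫ s, g s) / √lam := fun t =>
    hXae.mono fun ω hω => by simp only [Y, (hω t).1]
  have hWae : ∀ t, ∀ᵐ ω ∂P, W t ω = (∑' i, deriv g (t - τ i ω)) / √lam := fun t =>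
    hXae.mono fun ω hω => by simp only [W, (hω t).2]
  -- Outside one null set the two processes agree at all times at once, so their paths have the same
  -- crossings.
  have hZY : meanCrossings P Z 0 1 = meanCrossings P Y 0 1 := by
    refine meanCrossings_congr_ae ?_ 0 1
    filter_upwards [ae_normalizedProcess_shotNoise_eq hg hlam hτ hβ, hXae] with ω h1 h2 t
    rw [hZ, h1 t]
    simp only [Y, (h2 t).1]
  have hdm : Measurable (deriv g) := hg.contDiff_deriv.continuous.measurable
  have hWi : ∀ t, Integrable (W t) P := fun t =>
    ((hτ.integrable_tsum_comp (hdm.comp (measurable_const.sub measurable_id))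
      (integrable_sub_left_smul_volume hg.integrable_deriv lam t)).div_const (√lam)).congr
      ((hWae t).mono fun ω h => h.symm)
  have hWb : ∀ t, ∫ ω, |W t ω| ∂P ≤ lam * (∫ s, |deriv g s|) / √lam := by
    intro t
    have h1 : ∫ ω, |W t ω| ∂P = (∫ ω, |∑' i, deriv g (t - τ i ω)| ∂P) / √lam := by
      rw [← integral_div]
      refine integral_congr_ae ((hWae t).mono fun ω h => ?_)
      simp only
      rw [h, abs_div, abs_of_pos hsq]
    rw [h1]
    exact div_le_div_of_nonneg_right
      (integral_abs_tsum_comp_le hτ hlam hdm hg.integrable_deriv t) hsq.le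
  obtain ⟨hfin, hint, hF⟩ := meanCrossings_ae_ne_top_and_fourierPlus hYm hWm hY hWc 0 1
    (integrable_prod_of_integral_abs_le hWm hWc hWi hWb 0 1)
  rw [hZY]
  refine ⟨hfin, hint, fun u hu => ?_⟩
  obtain ⟨hI, hE⟩ := hF u
  rw [hE]
  set T : ℂ := ((√(2 * (∫ s, deriv g s ^ 2) / Real.pi)
    * Real.exp (-(∫ s, g s ^ 2) * u ^ 2 / 2) : ℝ) : ℂ) with hT
  have hconst : ∫ _ in Set.Icc (0 : ℝ) 1, T = T := by
    rw [setIntegral_const, Real.volume_real_Icc_of_le zero_le_one, sub_zero, one_smul]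
  -- The interval has length one, so the Gaussian term is its own integral over it, and the
  -- fixed-time bound, uniform in `t`, passes unchanged to the integral.
  rw [← hconst, ← integral_sub hI (integrable_const T)]
  have hb := norm_setIntegral_le_of_norm_le_const (μ := volume) (s := Set.Icc (0 : ℝ) 1)
    measure_Icc_lt_top (fun t _ => hest Ω P lam hlam τ hτ t (Y t) (W t) (hYm t) (hWm t) (hYae t)
      (hWae t) u hu)
  rw [Real.volume_real_Icc_of_le zero_le_one, sub_zero, mul_one] at hb
  exact hb
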